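/- **Setting.** Let $A\in\{0,1\}$ be a binary treatment, $X=(X_1,\dots,X_d)$ real-valued features, $Y^0,Y^1$ real-valued potential outcomes, and $Y=(1-A)Y^0+AY^1$ the observed outcome. Let $O_i=(a_i,x_i,y_i)$, $i\ge 1$, be i.i.d. with the law of $O=(A,X,Y)$. Let $e(x)=\Pr(A=1\mid X=x)$ be the propensity score and $$w^0(A,X)=\frac{\mathbf 1(A=0)}{1-e(X)},\qquad w^1(A,X)=\frac{\mathbf 1(A=1)}{e(X)} .$$ Let $k_Y:\mathbb R\times\mathbb R\to\mathbb R$ be a measurable, symmetric, positive (semi)definite kernel, fix $m\in\{1,\dots,d\}$, and put $$D_m^2(x)=\mathrm{MMD}^2\big(\mu^0_x,\mu^1_x\big)=\iint k_Y\,d\mu^0_x\,d\mu^0_x+\iint k_Y\,d\mu^1_x\,d\mu^1_x-2\iint k_Y\,d\mu^0_x\,d\mu^1_x ,$$ where $\mu^a_x$ is the (regular) conditional distribution of $Y^a$ given $X_m=x$. Given weights $\omega^{a}_i$ ($a\in\{0,1\}$, $1\le i\le n$), put $$\widehat D_m^2(x)=\sum_{i,j=1}^n\big(\omega^0_i\omega^0_j+\omega^1_i\omega^1_j\big)k_Y(y_i,y_j)-2\sum_{i,j=1}^n\omega^0_i\omega^1_j\,k_Y(y_i,y_j).$$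 **Assumptions.** 1. (Conditional ignorability) $(Y^0,Y^1)$ and $A$ are conditionally independent given $X$. 2. (Positivity) $0<e(x)<1$ for almost every value $x$ of $X$. 3. (Square integrability) With $K(O,O')=\big(w^0w^{0\prime}+w^1w^{1\prime}-w^0w^{1\prime}-w^1w^{0\prime}\big)k_Y(Y,Y')$, where primes denote an independent copy, $\mathbb E[K(O,O')^2]<\infty$ and $\mathbb E[K(O,O)]<\infty$. **Theorem 1.** (i) (Indicator weights.) Let $x\in\mathbb R$ with $\Pr(X_m=x)>0$ and $$\omega^a_i=\frac{\mathbf 1(x_{m,i}=x)}{\sum_{l=1}^n\mathbf 1(x_{m,l}=x)}\,w^a(a_i,x_i).$$ Then $\widehat D_m^2(x)\to D_m^2(x)$ in probability as $n\to\infty$. (ii) (Kernel-smoothing weights.) Let $\delta\ge2$ be an integer. Suppose that $X_m$ has a $\delta$ times continuously differentiable density, that $k_Y$ is continuous, that $\kappa:\mathbb R\to\mathbb R$ is measurable with $\int|u|^\delta|\kappa(u)|\,du<\infty$, $\int\kappa\ne0$ and $|\kappa(u)|\le\psi(|u|)$ for some nonincreasing integrable $\psi$ on $[0,\infty)$, and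 that the bandwidths satisfy $h_n\to0$ and $nh_n\to\infty$. Let $$\omega^a_i=\frac{\frac1{h_n}\kappa\big(\frac{x_{m,i}-x}{h_n}\big)}{\sum_{l=1}^n\frac1{h_n}\kappa\big(\frac{x_{m,l}-x}{h_n}\big)}\,w^a(a_i,x_i).$$ Then, for almost every $x$ with respect to the law of $X_m$, $\widehat D_m^2(x)\to D_m^2(x)$ in probability as $n\to\infty$. -/

import Mathlib

open MeasureTheory ProbabilityTheory Filter Topology

noncomputable section

namespace WCMMD

/-- An observation `(a, x, y)`: binary treatment, `d` features, real outcome. -/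
abbrev Obs (d : ℕ) : Type := Fin 2 × (Fin d → ℝ) × ℝ

/-- The observed data `(A, X, Y)` of an individual with potential outcomes `Y⁰, Y¹`;
the outcome is the potential outcome of the received treatment, `Y = (1 - A) Y⁰ + A Y¹`. -/
def observed {Ω : Type*} {d : ℕ} (A : Ω → Fin 2) (X : Ω → Fin d → ℝ) (Yp : Fin 2 → Ω → ℝ)
    (ω : Ω) : Obs d :=
  (A ω, X ω, (1 - ((A ω : ℕ) : ℝ)) * Yp 0 ω + ((A ω : ℕ) : ℝ) * Yp 1 ω)

/-- The propensity score `e(x) = P(A = 1 | X = x)`. -/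
def propensity {Ω : Type*} [MeasurableSpace Ω] {d : ℕ} (P : Measure Ω) [IsFiniteMeasure P]
    (A : Ω → Fin 2) (X : Ω → Fin d → ℝ) (x : Fin d → ℝ) : ℝ :=
  (condDistrib A X P x).real {1}

/-- Inverse probability weights: `w⁰ = 1(A = 0) / (1 - e(X))`, `w¹ = 1(A = 1) / e(X)`. -/
def ipw {d : ℕ} (e : (Fin d → ℝ) → ℝ) (a : Fin 2) (o : Obs d) : ℝ :=
  if o.1 = a then (if a = 1 then 1 / e o.2.1 else 1 / (1 - e o.2.1)) else 0

/-- The symmetric function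
`K(o, o') = (w⁰ w⁰' + w¹ w¹' - w⁰ w¹' - w¹ w⁰') k_Y(y, y')`. -/
def combinedKernel {d : ℕ} (e : (Fin d → ℝ) → ℝ) (kY : ℝ → ℝ → ℝ) (o o' : Obs d) : ℝ :=
  (ipw e 0 o * ipw e 0 o' + ipw e 1 o * ipw e 1 o'
    - ipw e 0 o * ipw e 1 o' - ipw e 1 o * ipw e 0 o') * kY o.2.2 o'.2.2

/-- The squared maximum mean discrepancy between two laws on the line. -/
def mmdSq (kY : ℝ → ℝ → ℝ) (μ ν : Measure ℝ) : ℝ :=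
  (∫ z, kY z.1 z.2 ∂(μ.prod μ)) + (∫ z, kY z.1 z.2 ∂(ν.prod ν))
    - 2 * ∫ z, kY z.1 z.2 ∂(μ.prod ν)

/-- `D²_m(x) = MMD²(P(Y⁰ | X_m = x), P(Y¹ | X_m = x))`. -/
def condMMDSq {Ω : Type*} [MeasurableSpace Ω] {d : ℕ} (P : Measure Ω) [IsFiniteMeasure P]
    (X : Ω → Fin d → ℝ) (Yp : Fin 2 → Ω → ℝ) (kY : ℝ → ℝ → ℝ) (m : Fin d) (x : ℝ) : ℝ :=
  mmdSq kY (condDistrib (Yp 0) (fun ω => X ω m) P x) (condDistrib (Yp 1) (fun ω => X ω m) P x)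

/-- The weights for a discrete feature, for the sample `o 0, …, o (n - 1)`:
`ω_i^a = 1(x_{m,i} = x) / (∑_l 1(x_{m,l} = x)) * w^a(a_i, x_i)`. -/
def discreteWeight {d : ℕ} (e : (Fin d → ℝ) → ℝ) (m : Fin d) (x : ℝ) (n : ℕ) (o : ℕ → Obs d)
    (a : Fin 2) (i : ℕ) : ℝ :=
  (if (o i).2.1 m = x then 1 else 0)
    / (∑ l ∈ Finset.range n, if (o l).2.1 m = x then (1 : ℝ) else 0) * ipw e a (o i)

/-- The Nadaraya–Watson weights for a continuous feature, with the smoothing kernel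
`k_{X_m}(s, t) = κ((s - t) / h)` of profile `κ` and bandwidth `h`. -/
def smoothWeight {d : ℕ} (e : (Fin d → ℝ) → ℝ) (κ : ℝ → ℝ) (h : ℝ) (m : Fin d) (x : ℝ) (n : ℕ)
    (o : ℕ → Obs d) (a : Fin 2) (i : ℕ) : ℝ :=
  (1 / h * κ (((o i).2.1 m - x) / h))
    / (∑ l ∈ Finset.range n, 1 / h * κ (((o l).2.1 m - x) / h)) * ipw e a (o i)

/-- The estimator of `D²_m(x)` built from weights `w a i = ω_i^a`. -/
def estimator {d : ℕ} (kY : ℝ → ℝ → ℝ) (n : ℕ) (o : ℕ → Obs d) (w : Fin 2 → ℕ → ℝ) : ℝ :=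
  (∑ i ∈ Finset.range n, ∑ j ∈ Finset.range n,
      (w 0 i * w 0 j + w 1 i * w 1 j) * kY (o i).2.2 (o j).2.2)
    - 2 * ∑ i ∈ Finset.range n, ∑ j ∈ Finset.range n, w 0 i * w 1 j * kY (o i).2.2 (o j).2.2

/-- Square integrability of `K`: in `L²` of the law of two independent observations, and with
finite expectation on the diagonal (`K(o, o)` is the squared norm of the weighted feature vector
`(w¹ - w⁰) k_Y(y, ·)`). -/
structure SquareIntegrable {d : ℕ} (μ : Measure (Obs d)) (K : Obs d → Obs d → ℝ) : Prop where
  memLp : MemLp (fun z : Obs d × Obs d => K z.1 z.2) 2 (μ.prod μ)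
  diag : Integrable (fun o => K o o) μ

/-- Admissible smoothing profile with finite moment of order `δ`: measurable, with nonzero
integral, and dominated by an integrable function that is nonincreasing in `|u|`. -/
structure IsSmoothingKernel (δ : ℕ) (κ : ℝ → ℝ) : Prop where
  measurable : Measurable κ
  moment : Integrable (fun u => u ^ δ * κ u)
  integral_ne_zero : ∫ u, κ u ≠ 0
  majorant : ∃ ψ : ℝ → ℝ, AntitoneOn ψ (Set.Ici 0) ∧ IntegrableOn ψ (Set.Ici 0) ∧
    ∀ u, |κ u| ≤ ψ |u|

/-- The law `μ` on the line has a density that is `δ` times continuously differentiable. -/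
def HasSmoothDensity (δ : ℕ) (μ : Measure ℝ) : Prop :=
  ∃ p : ℝ → ℝ, ContDiff ℝ δ p ∧ (∀ s, 0 ≤ p s) ∧
    μ = volume.withDensity (fun s => ENNReal.ofReal (p s))

end WCMMD

end

/-! The engine is inverse probability weighting. Given `X`, the treatment is independent of the
potential outcomes, so reweighting the observed law by `w^a` produces the joint law of `X` and `Y^a`
(`map_withDensity_ipw`), and a weighted mean localised at `X_m = x` estimates a mean under `μ^a_x`.
Both families of weights have the form `c i / C * w^a` with `C = ∑ c l`; by `estimator_eq` the
estimator is the quadratic form of `K` in the `c i`, divided by `C ^ 2`. It remains to find the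
limits in probability of numerator and denominator, after normalisation by powers of `n`, and to
divide.

For indicator weights the numerator is a V-statistic (`tendstoInMeasure_vStatistic`): its
off-diagonal part has variance `O(1/n)`, because only `O(n^3)` pairs of index pairs share an index,
and its diagonal has `n` terms against the normalisation `n^2`. Fubini and weighting in each
variable identify its mean as `Pr(X_m = x)^2 * D^2`.

For smoothing weights, write `k_Y(s, t) = ⟨φ s, φ t⟩` in a Hilbert space. The numerator is the
squared norm of a kernel average of `Φ = (w¹ - w⁰) φ(Y)`, and `D^2` is the squared distance of two
mean embeddings. The law of large numbers `tendstoInMeasure_average` asks that the means converge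
and that the second moments be `o(n)`. Both follow from convergence of approximate identities at
Lebesgue points (`ae_tendsto_integral_rescale_smul`): applied to the density times a conditional
mean of `φ(Y^a)` it gives the means; applied to `‖Φ‖^2 = K(o, o)`, with the majorant as profile, it
bounds the variance by `O(1/(n h))`. -/

/-! ### Approximate identities with a radially decreasing majorant -/

section ApproximateIdentity

open Set Metric
open scoped ENNReal

/-- An even function that decreases in `|u|` lies above the level `t` only on the interval around
`0` whose length is the measure of the superlevel set. -/
lemma superlevel_subset_closedBall {ψ : ℝ → ℝ} (hψ : Antitone ψ) {t : ℝ}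
    (ht : volume {u : ℝ | t < ψ |u|} ≠ ∞) (x : ℝ) {h : ℝ} (hh : 0 < h) :
    {s : ℝ | t < ψ (|s - x| / h)} ⊆
      closedBall x (h * ((volume {u : ℝ | t < ψ |u|}).toReal / 2)) := by
  intro s hs
  have hsub : closedBall (0 : ℝ) (|s - x| / h) ⊆ {u : ℝ | t < ψ |u|} := by
    intro u hu
    rw [mem_closedBall, dist_zero_right, Real.norm_eq_abs] at hu
    exact lt_of_lt_of_le hs (hψ hu)
  have hle := ENNReal.toReal_mono ht (measure_mono hsub)
  rw [Real.volume_closedBall, ENNReal.toReal_ofReal (by positivity)] at hle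
  rw [mem_closedBall, Real.dist_eq]
  have : |s - x| / h ≤ (volume {u : ℝ | t < ψ |u|}).toReal / 2 := by linarith
  rwa [div_le_iff₀ hh, mul_comm] at this

/-- If the ratio of `ν` to the length of centred intervals is bounded and tends to zero at `x`,
then the rescaled integrals of a radially decreasing profile against `ν` tend to zero. -/
theorem tendsto_lintegral_radial_zero {ν : Measure ℝ} {x : ℝ} {C : ℝ≥0∞} (hC : C ≠ ∞)
    (hbound : ∀ r, 0 ≤ r → ν (closedBall x r) ≤ C * volume (closedBall x r))
    (hlim : Tendsto (fun r => ν (closedBall x r) / volume (closedBall x r)) (𝓝[>] 0) (𝓝 0))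
    {ψ : ℝ → ℝ} (hψ : Antitone ψ) (hψ0 : ∀ u, 0 ≤ ψ u) (hψi : Integrable (fun u => ψ |u|)) :
    Tendsto (fun h => ENNReal.ofReal (1 / h) * ∫⁻ s, ENNReal.ofReal (ψ (|s - x| / h)) ∂ν)
      (𝓝[>] 0) (𝓝 0) := by
  have hfin : ∀ t ∈ Ioi (0 : ℝ), volume {u : ℝ | t < ψ |u|} ≠ ∞ := fun t ht =>
    (lt_of_le_of_lt (measure_mono fun u (hu : t < ψ |u|) => by
      show t ≤ ‖ψ |u|‖
      rw [Real.norm_eq_abs, abs_of_nonneg (hψ0 _)]; exact hu.le)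
      (hψi.measure_norm_ge_lt_top ht)).ne
  -- `R t` is half the length of the superlevel set at level `t`, that is, its radius as an interval
  -- around `0`.
  set R : ℝ → ℝ := fun t => (volume {u : ℝ | t < ψ |u|}).toReal / 2 with hR
  have hvol : ∀ t ∈ Ioi (0 : ℝ), ENNReal.ofReal (2 * R t) = volume {u : ℝ | t < ψ |u|} := by
    intro t ht
    rw [hR]
    simp only
    rw [mul_div_cancel₀ _ two_ne_zero, ENNReal.ofReal_toReal (hfin t ht)]
  have hR0 : ∀ t, 0 ≤ R t := fun t => by positivity
  have hscale : ∀ h, 0 < h → ∀ t ∈ Ioi (0 : ℝ),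
      ENNReal.ofReal (1 / h) * volume (closedBall x (h * R t)) =
        volume {u : ℝ | t < ψ |u|} := by
    intro h hh t ht
    rw [Real.volume_closedBall, ← ENNReal.ofReal_mul (by positivity), ← hvol t ht]
    congr 1
    field_simp
  -- Layer cake: integrate over levels `t` the `ν`-mass of superlevel sets, each inside the ball of
  -- radius `h * R t`. Dominated convergence in `t` then applies; the majorant `C` times the length
  -- at level `t` has integral `C * ∫ ψ |u|`.
  have hcake : ∀ h, ENNReal.ofReal (1 / h) * ∫⁻ s, ENNReal.ofReal (ψ (|s - x| / h)) ∂ν =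
      ∫⁻ t in Ioi 0, ENNReal.ofReal (1 / h) * ν {s | t < ψ (|s - x| / h)} := by
    intro h
    rw [lintegral_eq_lintegral_meas_lt ν (Eventually.of_forall fun s => hψ0 _)
      (hψ.measurable.comp (by fun_prop)).aemeasurable, lintegral_const_mul']
    exact ENNReal.ofReal_ne_top
  simp_rw [hcake]
  have hle : ∀ h, 0 < h → ∀ t ∈ Ioi (0 : ℝ), ν {s | t < ψ (|s - x| / h)} ≤
      ν (closedBall x (h * R t)) := fun h hh t ht =>
    measure_mono (superlevel_subset_closedBall hψ (hfin t ht) x hh)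
  have hle' : ∀ h, 0 < h → ∀ t ∈ Ioi (0 : ℝ),
      ENNReal.ofReal (1 / h) * ν (closedBall x (h * R t)) ≤ C * volume {u : ℝ | t < ψ |u|} := by
    intro h hh t ht
    rw [← hscale h hh t ht, ← mul_assoc, mul_comm C, mul_assoc]
    gcongr
    exact hbound _ (mul_nonneg hh.le (hR0 t))
  have key := tendsto_lintegral_filter_of_dominated_convergence
    (μ := volume.restrict (Ioi (0 : ℝ))) (l := 𝓝[>] (0 : ℝ))
    (F := fun h t => ENNReal.ofReal (1 / h) * ν {s | t < ψ (|s - x| / h)}) (f := fun _ => 0)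
    (fun t => C * volume {u : ℝ | t < ψ |u|}) ?_ ?_ ?_ ?_
  · simpa using key
  · refine Eventually.of_forall fun h => Measurable.const_mul ?_ _
    exact Antitone.measurable fun t t' htt' => measure_mono fun s hs => lt_of_le_of_lt htt' hs
  · filter_upwards [self_mem_nhdsWithin] with h hh
    filter_upwards [ae_restrict_mem measurableSet_Ioi] with t ht
    exact (mul_le_mul_right (hle h hh t ht) _).trans (hle' h hh t ht)
  · rw [lintegral_const_mul' _ _ hC, ← lintegral_eq_lintegral_meas_lt volume
      (Eventually.of_forall fun s => hψ0 _) hψi.aemeasurable]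
    exact ENNReal.mul_ne_top hC hψi.lintegral_lt_top.ne
  · filter_upwards [ae_restrict_mem measurableSet_Ioi] with t ht
    have hup : Tendsto (fun h => ENNReal.ofReal (1 / h) * ν (closedBall x (h * R t)))
        (𝓝[>] 0) (𝓝 0) := by
      -- `hlim` concerns positive radii only; when `R t = 0` the bound from `hbound` already forces
      -- mass zero.
      rcases (hR0 t).eq_or_lt with h0 | h0
      · refine tendsto_const_nhds.congr' ?_
        filter_upwards [self_mem_nhdsWithin] with h hh
        have := hle' h hh t ht
        rw [← hvol t ht, ← h0] at this
        simp only [mul_zero, ENNReal.ofReal_zero, nonpos_iff_eq_zero] at this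
        rw [← h0, mul_zero, this]
      · have h1 : Tendsto (fun h => h * R t) (𝓝[>] 0) (𝓝[>] 0) := by
          refine tendsto_nhdsWithin_iff.2 ⟨?_, ?_⟩
          · have : Tendsto (fun h : ℝ => h * R t) (𝓝 0) (𝓝 (0 * R t)) :=
              (continuous_id.mul continuous_const).tendsto 0
            rw [zero_mul] at this
            exact this.mono_left nhdsWithin_le_nhds
          · filter_upwards [self_mem_nhdsWithin] with h hh using mul_pos hh h0
        have h2 := ENNReal.Tendsto.const_mul (a := volume {u : ℝ | t < ψ |u|}) (hlim.comp h1)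
          (Or.inr (hfin t ht))
        rw [mul_zero] at h2
        refine h2.congr' ?_
        filter_upwards [self_mem_nhdsWithin] with h hh
        have hh : 0 < h := hh
        rw [← hscale h hh t ht, Function.comp_apply, mul_assoc]
        congr 1
        refine ENNReal.mul_div_cancel ?_ ?_
        · rw [Real.volume_closedBall]
          simp only [ne_eq, ENNReal.ofReal_eq_zero, not_le]
          positivity
        · rw [Real.volume_closedBall]
          exact ENNReal.ofReal_ne_top
    refine tendsto_of_tendsto_of_tendsto_of_le_of_le' tendsto_const_nhds hup
      (Eventually.of_forall fun _ => zero_le) ?_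
    filter_upwards [self_mem_nhdsWithin] with h hh
    exact mul_le_mul_right (hle h hh t ht) _

variable {E : Type*} [NormedAddCommGroup E]

/-- Almost every point is a Lebesgue point of an integrable function, in a form with a bound that
is uniform over all radii. -/
theorem ae_lebesguePoint_withDensity {f : ℝ → E} (hf : Integrable f) : ∀ᵐ x,
    (∃ C : ℝ≥0∞, C ≠ ∞ ∧ ∀ r, 0 ≤ r →
      volume.withDensity (fun s => ‖f s - f x‖ₑ) (closedBall x r) ≤
        C * volume (closedBall x r)) ∧
    Tendsto (fun r => volume.withDensity (fun s => ‖f s - f x‖ₑ) (closedBall x r) /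
      volume (closedBall x r)) (𝓝[>] 0) (𝓝 0) := by
  filter_upwards [IsUnifLocDoublingMeasure.ae_tendsto_average_norm_sub (μ := (volume : Measure ℝ))
    hf.locallyIntegrable 1] with x hx
  have hav := hx (l := 𝓝[>] (0 : ℝ)) (fun _ => x) id tendsto_id (by
    filter_upwards [self_mem_nhdsWithin] with r hr
    simpa using (le_of_lt hr : (0 : ℝ) ≤ r))
  have hdens : ∀ r, volume.withDensity (fun s => ‖f s - f x‖ₑ) (closedBall x r) =
      ∫⁻ s in closedBall x r, ‖f s - f x‖ₑ := fun r =>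
    withDensity_apply _ isClosed_closedBall.measurableSet
  have hint : ∀ r, IntegrableOn (fun s => f s - f x) (closedBall x r) := fun r =>
    hf.integrableOn.sub (integrableOn_const (measure_closedBall_lt_top).ne)
  have hlim : Tendsto (fun r => volume.withDensity (fun s => ‖f s - f x‖ₑ) (closedBall x r) /
      volume (closedBall x r)) (𝓝[>] 0) (𝓝 0) := by
    have h0 := ENNReal.tendsto_ofReal hav
    rw [ENNReal.ofReal_zero] at h0
    refine h0.congr' ?_
    filter_upwards [self_mem_nhdsWithin] with r hr
    have hr : 0 < r := hr
    rw [hdens, ← ofReal_integral_norm_eq_lintegral_enorm (hint r), setAverage_eq, smul_eq_mul,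
      measureReal_def, id, inv_mul_eq_div, ENNReal.ofReal_div_of_pos, ENNReal.ofReal_toReal]
    · exact measure_closedBall_lt_top.ne
    · rw [Real.volume_closedBall, ENNReal.toReal_ofReal] <;> positivity
  refine ⟨?_, hlim⟩
  obtain ⟨r₀, hr₀, hr⟩ : ∃ r₀ > 0, ∀ r, 0 < r → r < r₀ →
      volume.withDensity (fun s => ‖f s - f x‖ₑ) (closedBall x r) /
        volume (closedBall x r) ≤ 1 := by
    have := hlim.eventually (ge_mem_nhds (zero_lt_one : (0 : ℝ≥0∞) < 1))
    obtain ⟨r₀, hr₀, h⟩ := mem_nhdsGT_iff_exists_Ioo_subset.1 this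
    exact ⟨r₀, hr₀, fun r h1 h2 => h ⟨h1, h2⟩⟩
  have hv0 : volume (closedBall x r₀) ≠ 0 := by
    rw [Real.volume_closedBall]
    simpa using hr₀
  -- The `1` serves radii below `r₀`, where the ratio is at most `1`; the rest serves larger radii,
  -- where the mass is at most `∫ ‖f‖ + ‖f x‖ * |B_r|` and `|B_r| ≥ |B_{r₀}|`.
  refine ⟨1 + ((∫⁻ s, ‖f s‖ₑ) / volume (closedBall x r₀) + ‖f x‖ₑ), ?_, fun r hr0 => ?_⟩
  · have := ENNReal.div_ne_top (hf.2.ne : (∫⁻ s, ‖f s‖ₑ) ≠ ∞) hv0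
    finiteness
  rcases hr0.eq_or_lt with rfl | hrpos
  · simp only [closedBall_zero]
    rw [(withDensity_absolutelyContinuous volume _) (measure_singleton x)]
    exact zero_le
  rcases lt_or_ge r r₀ with hlt | hge
  · rw [add_mul, one_mul]
    refine le_add_right ?_
    have := hr r hrpos hlt
    rwa [ENNReal.div_le_iff, one_mul] at this
    · rw [Real.volume_closedBall]
      simpa using hrpos
    · exact measure_closedBall_lt_top.ne
  · calc volume.withDensity (fun s => ‖f s - f x‖ₑ) (closedBall x r)
        ≤ ∫⁻ s in closedBall x r, (‖f s‖ₑ + ‖f x‖ₑ) := by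
          rw [hdens]
          exact lintegral_mono fun s => enorm_sub_le
      _ ≤ (∫⁻ s, ‖f s‖ₑ) + ‖f x‖ₑ * volume (closedBall x r) := by
          rw [lintegral_add_right _ measurable_const, setLIntegral_const]
          gcongr
          exact Measure.restrict_le_self
      _ ≤ ((∫⁻ s, ‖f s‖ₑ) / volume (closedBall x r₀) + ‖f x‖ₑ) * volume (closedBall x r) := by
          rw [add_mul]
          gcongr
          calc (∫⁻ s, ‖f s‖ₑ) = (∫⁻ s, ‖f s‖ₑ) / volume (closedBall x r₀) *
                volume (closedBall x r₀) :=
                (ENNReal.div_mul_cancel hv0 measure_closedBall_lt_top.ne).symm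
            _ ≤ _ := by gcongr
      _ ≤ _ := by
          exact mul_le_mul_left le_add_self _

/-- Extending a function that is nonincreasing and integrable on the half line evenly to the
line. -/
lemma integrable_comp_abs_of_antitone {ψ : ℝ → ℝ} (hψ : Antitone ψ) (hψ0 : ∀ u, 0 ≤ ψ u)
    (hψi : IntegrableOn ψ (Ici 0)) : Integrable (fun u => ψ |u|) := by
  have h1 : Integrable ((Ici (0 : ℝ)).indicator ψ) := hψi.integrable_indicator measurableSet_Ici
  refine (h1.add h1.comp_neg).mono' (hψ.measurable.comp measurable_abs).aestronglyMeasurable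
    (Eventually.of_forall fun u => ?_)
  rw [Real.norm_eq_abs, abs_of_nonneg (hψ0 _)]
  have hnn : ∀ v, 0 ≤ (Ici (0 : ℝ)).indicator ψ v := fun v =>
    indicator_nonneg (fun _ _ => hψ0 _) _
  rcases le_total 0 u with hu | hu
  · rw [abs_of_nonneg hu]
    simpa [indicator_of_mem (show u ∈ Ici (0 : ℝ) from hu)] using hnn (-u)
  · rw [abs_of_nonpos hu]
    simpa [indicator_of_mem (show -u ∈ Ici (0 : ℝ) by simpa using hu)] using hnn u

/-- A majorant that is nonincreasing on the half line may be taken nonincreasing and nonnegative on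
the whole line. -/
lemma exists_antitone_majorant {κ ψ : ℝ → ℝ} (hψ : AntitoneOn ψ (Ici 0))
    (hψi : IntegrableOn ψ (Ici 0)) (hκ : ∀ u, |κ u| ≤ ψ |u|) :
    ∃ φ : ℝ → ℝ, Antitone φ ∧ (∀ u, 0 ≤ φ u) ∧ Integrable (fun u => φ |u|) ∧
      ∀ u, |κ u| ≤ φ |u| := by
  -- Freeze the value `ψ 0` on the negative half line; nonnegativity comes from dominating `|κ|`.
  have hφ : Antitone fun u => ψ (max u 0) := fun u v huv =>
    hψ (mem_Ici.2 (le_max_right _ _)) (mem_Ici.2 (le_max_right _ _)) (max_le_max_right 0 huv)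
  have hφ0 : ∀ u, 0 ≤ ψ (max u 0) := fun u => by
    have := (abs_nonneg _).trans (hκ (max u 0))
    rwa [abs_of_nonneg (le_max_right u 0)] at this
  refine ⟨_, hφ, hφ0, integrable_comp_abs_of_antitone hφ hφ0 ?_, fun u => ?_⟩
  · refine hψi.congr_fun (fun u hu => ?_) measurableSet_Ici
    simp only [max_eq_left (show (0 : ℝ) ≤ u from hu)]
  · simpa only [max_eq_left (abs_nonneg u)] using hκ u

lemma integral_rescale (κ : ℝ → ℝ) (x : ℝ) {h : ℝ} (hh : 0 < h) :
    ∫ s, 1 / h * κ ((s - x) / h) = ∫ u, κ u := by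
  rw [integral_const_mul, integral_sub_right_eq_self (fun s => κ (s / h)) x,
    Measure.integral_comp_div, abs_of_pos hh, smul_eq_mul]
  field_simp

lemma integrable_rescale {κ : ℝ → ℝ} (hκ : Integrable κ) (x : ℝ) {h : ℝ} (hh : 0 < h) :
    Integrable fun s => 1 / h * κ ((s - x) / h) :=
  ((hκ.comp_div hh.ne').comp_sub_right x).const_mul _

/-- **Approximate identities converge almost everywhere**: if the profile `κ` has a radially
decreasing integrable majorant, its rescalings applied to an integrable function `f` converge to
`(∫ κ) f` at almost every point. -/
theorem ae_tendsto_integral_rescale_smul [NormedSpace ℝ E] [CompleteSpace E] {f : ℝ → E}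
    (hf : Integrable f) {κ ψ : ℝ → ℝ} (hκ : Measurable κ) (hψ : Antitone ψ)
    (hψ0 : ∀ u, 0 ≤ ψ u) (hψi : Integrable (fun u => ψ |u|)) (hκψ : ∀ u, |κ u| ≤ ψ |u|) :
    ∀ᵐ x, Tendsto (fun h => ∫ s, (1 / h * κ ((s - x) / h)) • f s) (𝓝[>] 0)
      (𝓝 ((∫ u, κ u) • f x)) := by
  have hκi : Integrable κ := hψi.mono' hκ.aestronglyMeasurable (Eventually.of_forall hκψ)
  filter_upwards [ae_lebesguePoint_withDensity hf] with x ⟨⟨C, hC, hbound⟩, hlim⟩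
  have key := tendsto_lintegral_radial_zero hC hbound hlim hψ hψ0 hψi
  rw [tendsto_iff_edist_tendsto_0]
  refine tendsto_of_tendsto_of_tendsto_of_le_of_le' tendsto_const_nhds key
    (Eventually.of_forall fun _ => zero_le) ?_
  filter_upwards [self_mem_nhdsWithin] with h hh
  have hh : 0 < h := hh
  have hκm : Measurable fun s => 1 / h * κ ((s - x) / h) := by fun_prop
  have hi1 : Integrable fun s => (1 / h * κ ((s - x) / h)) • f s := by
    refine hf.bdd_smul (1 / h * ψ 0) hκm.aestronglyMeasurable
      (Eventually.of_forall fun s => ?_)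
    rw [norm_mul, Real.norm_of_nonneg (by positivity : 0 ≤ 1 / h)]
    gcongr
    exact (hκψ _).trans (hψ (abs_nonneg _))
  have hi2 : Integrable fun s => (1 / h * κ ((s - x) / h)) • f x :=
    (integrable_rescale hκi x hh).smul_const _
  -- Since every rescaling has integral `∫ κ`, the error is the integral of the rescaled `κ` against
  -- `f s - f x`, hence at most the radial integral of `ψ` against the measure with density `‖f s -
  -- f x‖`.
  rw [edist_eq_enorm_sub, ← integral_rescale κ x hh, ← integral_smul_const,
    ← integral_sub hi1 hi2]
  calc _ ≤ ∫⁻ s, ‖(1 / h * κ ((s - x) / h)) • f s - (1 / h * κ ((s - x) / h)) • f x‖ₑ :=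
        enorm_integral_le_lintegral_enorm _
    _ ≤ ∫⁻ s, ENNReal.ofReal (1 / h) * (‖f s - f x‖ₑ * ENNReal.ofReal (ψ (|s - x| / h))) := by
        refine lintegral_mono fun s => ?_
        simp only
        rw [← smul_sub, enorm_smul, enorm_mul, mul_comm (‖f s - f x‖ₑ), mul_assoc]
        gcongr
        · rw [← ofReal_norm, Real.norm_of_nonneg (by positivity : 0 ≤ 1 / h)]
        · rw [← ofReal_norm]
          refine ENNReal.ofReal_le_ofReal ((hκψ _).trans_eq ?_)
          rw [abs_div, abs_of_pos hh]
    _ = _ := by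
        rw [lintegral_const_mul' _ _ ENNReal.ofReal_ne_top,
          lintegral_withDensity_eq_lintegral_mul_non_measurable₀ _ ?_ ?_]
        · rfl
        · exact (hf.1.sub aestronglyMeasurable_const).enorm
        · exact Eventually.of_forall fun s => enorm_lt_top

end ApproximateIdentity

/-! ### Feature maps of positive semidefinite kernels -/

section FeatureMap

variable {S : Type*} {k : S → S → ℝ}

/-- A real positive semidefinite kernel is the Gram matrix of a map into a Hilbert space. -/
theorem Matrix.PosSemidef.exists_featureMap.{u} {S : Type u} {k : S → S → ℝ}
    (hk : (Matrix.of k).PosSemidef) :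
    ∃ (H : Type u) (_ : NormedAddCommGroup H) (_ : InnerProductSpace ℝ H) (_ : CompleteSpace H)
      (φ : S → H), ∀ s t, inner ℝ (φ s) (φ t) = k s t := by
  -- `RKHS` takes operator-valued kernels, so `k s t` acts as a multiple of the identity of `ℝ`; the
  -- feature of `s` is the kernel function at `s` applied to `1`.
  let K : Matrix S S (ℝ →L[ℝ] ℝ) := Matrix.of fun s t => k s t • (1 : ℝ →L[ℝ] ℝ)
  have hsymm : ∀ s t, k s t = k t s := fun s t => by simpa using hk.1.apply t s
  have hK : K.PosSemidef := by
    have hiff := (RKHS.posSemidef_tfae (K := K)).out 0 2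
    refine hiff.mpr ⟨?_, fun v => ?_⟩
    · ext s t
      simp [K, hsymm s t]
    · have := hk.2 v
      simp only [K, Matrix.of_apply, star_trivial] at this ⊢
      refine this.trans_eq ?_
      simp only [Finsupp.sum, RCLike.re_to_real]
      refine Finset.sum_congr rfl fun s _ => Finset.sum_congr rfl fun t _ => ?_
      simp [hsymm t s]
      ring
  have : Fact K.PosSemidef := ⟨hK⟩
  refine ⟨RKHS.OfKernel K, inferInstance, inferInstance, inferInstance,
    fun s => RKHS.kerFun (RKHS.OfKernel K) s 1, fun s t => ?_⟩
  have h := RKHS.kernel_inner (RKHS.OfKernel K) t s (1 : ℝ) (1 : ℝ)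
  rw [RKHS.OfKernel.kernel_ofKernel] at h
  simp [K] at h
  rw [hsymm]
  simp [h]

lemma Matrix.PosSemidef.kernel_symm (hk : (Matrix.of k).PosSemidef) (s t : S) :
    k s t = k t s := by
  simpa using hk.1.apply t s

variable {H : Type*} [NormedAddCommGroup H] [InnerProductSpace ℝ H] {φ : S → H}

lemma norm_sq_featureMap (hφ : ∀ s t, inner ℝ (φ s) (φ t) = k s t) (s : S) :
    ‖φ s‖ ^ 2 = k s s := by
  rw [← hφ, real_inner_self_eq_norm_sq]

lemma norm_featureMap (hφ : ∀ s t, inner ℝ (φ s) (φ t) = k s t) (s : S) :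
    ‖φ s‖ = √(k s s) := by
  rw [← norm_sq_featureMap hφ, Real.sqrt_sq (norm_nonneg _)]

/-- The feature map of a continuous kernel is continuous. -/
lemma continuous_featureMap [TopologicalSpace S] (hφ : ∀ s t, inner ℝ (φ s) (φ t) = k s t)
    (hk : Continuous fun z : S × S => k z.1 z.2) : Continuous φ := by
  rw [continuous_iff_continuousAt]
  intro s
  have hk1 : Continuous fun t => k t t := hk.comp (continuous_id.prodMk continuous_id)
  have hk2 : Continuous fun t => k t s := hk.comp (continuous_id.prodMk continuous_const)
  -- The radicand is `‖φ t - φ s‖ ^ 2` expanded; it is continuous in `t` and vanishes at `t = s`.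
  have hlim : Tendsto (fun t => √(k t t - 2 * k t s + k s s)) (𝓝 s) (𝓝 0) := by
    have := (((hk1.sub (hk2.const_mul 2)).add (continuous_const (y := k s s))).sqrt).tendsto s
    simpa [two_mul] using this
  rw [ContinuousAt, tendsto_iff_norm_sub_tendsto_zero]
  refine hlim.congr fun t => ?_
  rw [← Real.sqrt_sq (norm_nonneg (φ t - φ s)), norm_sub_sq_real, hφ, norm_sq_featureMap hφ,
    norm_sq_featureMap hφ]

/-- Cauchy–Schwarz in the feature space. It dominates the kernel by a product of one-variable
functions, which later justifies Fubini. -/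
lemma abs_kernel_le (hφ : ∀ s t, inner ℝ (φ s) (φ t) = k s t) (s t : S) :
    |k s t| ≤ √(k s s) * √(k t t) := by
  rw [← hφ, ← norm_featureMap hφ, ← norm_featureMap hφ]
  exact abs_real_inner_le_norm _ _

end FeatureMap

/-! ### Convergence in measure -/

section InMeasure

variable {Ω E F G : Type*} [MeasurableSpace Ω] {μ : Measure Ω}

/-- Continuous mapping for a pair of sequences that converge in measure to constants. -/
theorem MeasureTheory.TendstoInMeasure.map₂_const [PseudoMetricSpace E] [PseudoMetricSpace F]
    [PseudoMetricSpace G] {ι : Type*} {l : Filter ι} {f : ι → Ω → E} {g : ι → Ω → F} {a : E} {b : F}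
    (hf : TendstoInMeasure μ f l fun _ => a) (hg : TendstoInMeasure μ g l fun _ => b)
    {Φ : E → F → G} (hΦ : ContinuousAt (fun z : E × F => Φ z.1 z.2) (a, b)) :
    TendstoInMeasure μ (fun n ω => Φ (f n ω) (g n ω)) l fun _ => Φ a b := by
  rw [tendstoInMeasure_iff_dist] at hf hg ⊢
  intro ε hε
  obtain ⟨δ, hδ, h⟩ := Metric.continuousAt_iff.1 hΦ ε hε
  have hsum := (hf δ hδ).add (hg δ hδ)
  rw [add_zero] at hsum
  refine tendsto_of_tendsto_of_tendsto_of_le_of_le tendsto_const_nhds hsum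
    (fun _ => zero_le) fun n => ?_
  refine (measure_mono fun ω hω => ?_).trans (measure_union_le _ _)
  by_contra hnot
  simp only [Set.mem_union, Set.mem_ofPred_eq, not_or, not_le] at hnot
  have := @h (f n ω, g n ω) (by rw [Prod.dist_eq]; exact max_lt hnot.1 hnot.2)
  exact absurd hω (by simpa using this)

lemma tendstoInMeasure_of_tendsto [PseudoMetricSpace E] {ι : Type*} {l : Filter ι} {u : ι → E}
    {a : E} (h : Tendsto u l (𝓝 a)) : TendstoInMeasure μ (fun n _ => u n) l fun _ => a := by
  rw [tendstoInMeasure_iff_dist]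
  intro ε hε
  refine tendsto_const_nhds.congr' ?_
  filter_upwards [Metric.tendsto_nhds.1 h ε hε] with n hn
  have : {_x : Ω | ε ≤ dist (u n) a} = ∅ := by
    ext; simpa using hn
  rw [this, measure_empty]

/-- Markov's inequality: vanishing moments give convergence in measure. -/
lemma tendstoInMeasure_zero_of_tendsto_integral_pow [NormedAddCommGroup E] [IsFiniteMeasure μ]
    {ι : Type*} {l : Filter ι} {f : ι → Ω → E} (q : ℕ)
    (hf : ∀ n, Integrable (fun ω => ‖f n ω‖ ^ q) μ)
    (h : Tendsto (fun n => ∫ ω, ‖f n ω‖ ^ q ∂μ) l (𝓝 0)) :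
    TendstoInMeasure μ f l fun _ => 0 := by
  rw [tendstoInMeasure_iff_measureReal_norm]
  intro ε hε
  have hε' : 0 < ε ^ q := by positivity
  have h' := h.div_const (ε ^ q)
  rw [zero_div] at h'
  refine squeeze_zero (fun _ => measureReal_nonneg) (fun n => ?_) h'
  rw [le_div_iff₀ hε', mul_comm]
  refine le_trans ?_ (mul_meas_ge_le_integral_of_nonneg
    (Eventually.of_forall fun ω => by positivity) (hf n) (ε ^ q))
  refine mul_le_mul_of_nonneg_left (measureReal_mono fun ω hω => ?_) hε'.le
  simp only [sub_zero, Set.mem_ofPred_eq] at hω ⊢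
  gcongr

end InMeasure

/-! ### Laws of large numbers -/

section LLN

variable {Ω S H : Type*} [MeasurableSpace Ω] [MeasurableSpace S] {Q : Measure Ω}
  {O : ℕ → Ω → S} {μ : Measure S}
  [NormedAddCommGroup H] [InnerProductSpace ℝ H]

/-- Pythagoras in `L²(Q; H)`: expanding the inner product leaves only diagonal terms. -/
lemma integral_norm_sum_sq_of_orthogonal {ι : Type*} {ζ : ι → Ω → H} (s : Finset ι)
    (hζ : ∀ i, MemLp (ζ i) 2 Q)
    (horth : ∀ i j, i ≠ j → ∫ ω, inner ℝ (ζ i ω) (ζ j ω) ∂Q = 0) :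
    ∫ ω, ‖∑ i ∈ s, ζ i ω‖ ^ 2 ∂Q = ∑ i ∈ s, ∫ ω, ‖ζ i ω‖ ^ 2 ∂Q := by
  classical
  have hint : ∀ i j, Integrable (fun ω => inner ℝ (ζ i ω) (ζ j ω)) Q := fun i j => by
    refine ((hζ i).norm.integrable_mul (hζ j).norm).mono ((hζ i).1.inner (hζ j).1)
      (Eventually.of_forall fun ω => ?_)
    simpa using norm_inner_le_norm (𝕜 := ℝ) (ζ i ω) (ζ j ω)
  simp_rw [← real_inner_self_eq_norm_sq, sum_inner, inner_sum]
  rw [integral_finsetSum _ fun i _ => integrable_finsetSum _ fun j _ => hint i j]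
  refine Finset.sum_congr rfl fun i hi => ?_
  rw [integral_finsetSum _ fun j _ => hint i j, Finset.sum_eq_single i]
  · exact fun j _ hji => horth i j hji.symm
  · exact fun h => absurd hi h

/-- **Weak law of large numbers** for triangular arrays of functions of an i.i.d. sample, with
values in a Hilbert space. -/
theorem tendstoInMeasure_average [CompleteSpace H] [IsProbabilityMeasure Q]
    [IsProbabilityMeasure μ]
    (hO : ∀ i, Measurable (O i)) (hind : iIndepFun O Q) (hlaw : ∀ i, Q.map (O i) = μ)
    {Ξ : ℕ → S → H} (hΞ : ∀ n, MemLp (Ξ n) 2 μ) {L : H}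
    (hmean : Tendsto (fun n => ∫ o, Ξ n o ∂μ) atTop (𝓝 L))
    (hvar : Tendsto (fun n : ℕ => (n : ℝ)⁻¹ * ∫ o, ‖Ξ n o‖ ^ 2 ∂μ) atTop (𝓝 0)) :
    TendstoInMeasure Q (fun (n : ℕ) ω => (n : ℝ)⁻¹ • ∑ i ∈ Finset.range n, Ξ n (O i ω)) atTop
      fun _ => L := by
  have hmp : ∀ i, MeasurePreserving (O i) Q μ := fun i => ⟨hO i, hlaw i⟩
  set c : ℕ → H := fun n => ∫ o, Ξ n o ∂μ with hc
  have hζ : ∀ n, MemLp (fun o => Ξ n o - c n) 2 μ := fun n => (hΞ n).sub (memLp_const _)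
  have hζO : ∀ n i, MemLp (fun ω => Ξ n (O i ω) - c n) 2 Q := fun n i =>
    (hζ n).comp_measurePreserving (hmp i)
  have hcentre : ∀ n, ∫ o, (Ξ n o - c n) ∂μ = 0 := fun n => by
    rw [integral_sub ((hΞ n).integrable one_le_two) (integrable_const _)]
    simp [hc]
  have hcentreO : ∀ n i, ∫ ω, (Ξ n (O i ω) - c n) ∂Q = 0 := fun n i => by
    rw [← hcentre n, ← hlaw i, integral_map (hO i).aemeasurable]
    rw [hlaw i]; exact (hζ n).1
  -- By independence the expectation passes inside the bilinear inner product, where each centred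
  -- factor has mean zero.
  have horth : ∀ n i j, i ≠ j →
      ∫ ω, inner ℝ (Ξ n (O i ω) - c n) (Ξ n (O j ω) - c n) ∂Q = 0 := by
    intro n i j hij
    have h : ∫ ω, inner ℝ (Ξ n (O i ω) - c n) (Ξ n (O j ω) - c n) ∂Q =
        inner ℝ (∫ ω, (Ξ n (O i ω) - c n) ∂Q) (∫ ω, (Ξ n (O j ω) - c n) ∂Q) :=
      (hind.indepFun hij).integral_bilin_comp_comp (𝕜 := ℝ) (hO i).aemeasurable
      (hO j).aemeasurable (f := fun o => Ξ n o - c n) (g := fun o => Ξ n o - c n)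
      (by rw [hlaw]; exact (hζ n).integrable one_le_two)
      (by rw [hlaw]; exact (hζ n).integrable one_le_two) (innerSL ℝ)
    rw [h, hcentreO n i, inner_zero_left]
  -- A variance is at most the second moment, so `hvar` can be stated without centring.
  have hsq : ∀ n i, ∫ ω, ‖Ξ n (O i ω) - c n‖ ^ 2 ∂Q ≤ ∫ o, ‖Ξ n o‖ ^ 2 ∂μ := by
    intro n i
    have h1 : ∫ ω, ‖Ξ n (O i ω) - c n‖ ^ 2 ∂Q = ∫ o, ‖Ξ n o - c n‖ ^ 2 ∂μ := by
      rw [← hlaw i, integral_map (hO i).aemeasurable]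
      rw [hlaw i]; exact (hζ n).1.norm.pow 2
    have hi : Integrable (Ξ n) μ := (hΞ n).integrable one_le_two
    have h2 : ∫ o, ‖Ξ n o - c n‖ ^ 2 ∂μ = ∫ o, ‖Ξ n o‖ ^ 2 ∂μ - ‖c n‖ ^ 2 := by
      have e1 : Integrable (fun o => ‖Ξ n o‖ ^ 2) μ := (hΞ n).integrable_norm_pow two_ne_zero
      have e2 : Integrable (fun o => 2 * inner ℝ (Ξ n o) (c n)) μ :=
        (hi.inner_const (c n)).const_mul 2
      have e3 : Integrable (fun o => ‖Ξ n o‖ ^ 2 - 2 * inner ℝ (Ξ n o) (c n)) μ := e1.sub e2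
      simp_rw [norm_sub_sq_real]
      rw [integral_add e3 (integrable_const _), integral_sub e1 e2, integral_const_mul]
      simp_rw [fun o => real_inner_comm (c n) (Ξ n o)]
      rw [integral_inner hi, show ∫ o, Ξ n o ∂μ = c n from rfl, real_inner_self_eq_norm_sq]
      simp
      ring
    rw [h1, h2]
    linarith [sq_nonneg ‖c n‖]
  have hdev : TendstoInMeasure Q
      (fun (n : ℕ) ω => (n : ℝ)⁻¹ • ∑ i ∈ Finset.range n, (Ξ n (O i ω) - c n)) atTop
      fun _ => 0 := by
    have hsumLp : ∀ n : ℕ,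
        MemLp (fun ω => (n : ℝ)⁻¹ • ∑ i ∈ Finset.range n, (Ξ n (O i ω) - c n)) 2 Q := fun n =>
      (memLp_finsetSum _ fun i _ => hζO n i).const_smul _
    refine tendstoInMeasure_zero_of_tendsto_integral_pow 2
      (fun n => (hsumLp n).integrable_norm_pow two_ne_zero) ?_
    refine squeeze_zero (fun n => integral_nonneg fun ω => by positivity) (fun n => ?_) hvar
    simp_rw [norm_smul, mul_pow]
    rw [integral_const_mul, integral_norm_sum_sq_of_orthogonal _ (hζO n) (horth n)]
    rcases Nat.eq_zero_or_pos n with rfl | hn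
    · simp
    have hn' : (0 : ℝ) < n := by exact_mod_cast hn
    calc ‖(n : ℝ)⁻¹‖ ^ 2 * ∑ i ∈ Finset.range n, ∫ ω, ‖Ξ n (O i ω) - c n‖ ^ 2 ∂Q
        ≤ ‖(n : ℝ)⁻¹‖ ^ 2 * ∑ i ∈ Finset.range n, ∫ o, ‖Ξ n o‖ ^ 2 ∂μ := by
          gcongr with i hi
          exact hsq n i
      _ = (n : ℝ)⁻¹ * ∫ o, ‖Ξ n o‖ ^ 2 ∂μ := by
          rw [Finset.sum_const, Finset.card_range, nsmul_eq_mul, norm_inv, Real.norm_natCast]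
          field_simp
  have hsum := hdev.map₂_const (tendstoInMeasure_of_tendsto (μ := Q) hmean)
    (Φ := fun a b : H => a + b) continuous_add.continuousAt
  rw [zero_add] at hsum
  refine hsum.congr' ?_ (ae_eq_refl _)
  filter_upwards [eventually_gt_atTop 0] with n hn
  have hn' : (n : ℝ) ≠ 0 := by exact_mod_cast hn.ne'
  refine Eventually.of_forall fun ω => ?_
  simp only [Finset.sum_sub_distrib, Finset.sum_const, Finset.card_range, smul_sub]
  rw [← Nat.cast_smul_eq_nsmul ℝ, smul_smul, inv_mul_cancel₀ hn', one_smul, sub_add_cancel]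

end LLN

/-! ### V-statistics -/

section VStatistic

variable {Ω S : Type*} [MeasurableSpace Ω] [MeasurableSpace S] {Q : Measure Ω}
  [IsProbabilityMeasure Q] {O : ℕ → Ω → S} {μ : Measure S}

lemma measurePreserving_prodMk_of_iid (hO : ∀ i, Measurable (O i)) (hind : iIndepFun O Q)
    (hlaw : ∀ i, Q.map (O i) = μ) {i j : ℕ} (hij : i ≠ j) :
    MeasurePreserving (fun ω => (O i ω, O j ω)) Q (μ.prod μ) := by
  refine ⟨(hO i).prodMk (hO j), ?_⟩
  rw [(hind.indepFun hij).map_prod_eq_prod_map_map (hO i).aemeasurable (hO j).aemeasurable,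
    hlaw, hlaw]

/-- The number of pairs that meet a given pair. -/
lemma sum_offDiag_not_disjoint_le (n : ℕ) (p : ℕ × ℕ) {V : ℝ} (hV : 0 ≤ V) :
    ∑ q ∈ (Finset.range n).offDiag,
      (if p.1 ≠ q.1 ∧ p.1 ≠ q.2 ∧ p.2 ≠ q.1 ∧ p.2 ≠ q.2 then 0 else V) ≤ 4 * n * V := by
  have hcard : ∀ a : ℕ, ∑ b ∈ Finset.range n, (if a = b then V else 0) ≤ V := by
    intro a
    rw [Finset.sum_ite_eq]
    split_ifs
    exacts [le_rfl, hV]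
  -- Two pairs meet only through one of four coordinate equalities, and each equality holds for at
  -- most `n` pairs `q`.
  calc _ ≤ ∑ q ∈ (Finset.range n).offDiag,
        ((if p.1 = q.1 then V else 0) + (if p.1 = q.2 then V else 0)
          + (if p.2 = q.1 then V else 0) + (if p.2 = q.2 then V else 0)) := by
        refine Finset.sum_le_sum fun q _ => ?_
        split_ifs <;> first | linarith | (exfalso; tauto)
    _ ≤ ∑ q ∈ Finset.range n ×ˢ Finset.range n,
        ((if p.1 = q.1 then V else 0) + (if p.1 = q.2 then V else 0)
          + (if p.2 = q.1 then V else 0) + (if p.2 = q.2 then V else 0)) := by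
        refine Finset.sum_le_sum_of_subset_of_nonneg ?_ fun q _ _ => ?_
        · exact fun q hq => by
            rw [Finset.mem_offDiag] at hq
            exact Finset.mem_product.2 ⟨hq.1, hq.2.1⟩
        · split_ifs <;> positivity
    _ ≤ 4 * n * V := by
        have h1 : ∀ a : ℕ, ∑ q ∈ Finset.range n ×ˢ Finset.range n,
            (if a = q.1 then V else 0) ≤ n * V := by
          intro a
          rw [Finset.sum_product_right]
          simpa using Finset.sum_le_card_nsmul (Finset.range n) _ V fun _ _ => hcard a
        have h2 : ∀ a : ℕ, ∑ q ∈ Finset.range n ×ˢ Finset.range n,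
            (if a = q.2 then V else 0) ≤ n * V := by
          intro a
          rw [Finset.sum_product]
          simpa using Finset.sum_le_card_nsmul (Finset.range n) _ V fun _ _ => hcard a
        simp only [Finset.sum_add_distrib]
        linarith [h1 p.1, h1 p.2, h2 p.1, h2 p.2]

/-- The second moment of an off-diagonal sum of a centred function of two observations. -/
theorem integral_offDiag_sum_sq_le (hO : ∀ i, Measurable (O i)) (hind : iIndepFun O Q)
    (hlaw : ∀ i, Q.map (O i) = μ) {g : S × S → ℝ} (hg : MemLp g 2 (μ.prod μ))
    (hg0 : ∫ z, g z ∂(μ.prod μ) = 0) (n : ℕ) :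
    ∫ ω, (∑ p ∈ (Finset.range n).offDiag, g (O p.1 ω, O p.2 ω)) ^ 2 ∂Q ≤
      4 * n ^ 3 * ∫ z, g z ^ 2 ∂(μ.prod μ) := by
  set V := ∫ z, g z ^ 2 ∂(μ.prod μ) with hV
  have hV0 : 0 ≤ V := integral_nonneg fun z => sq_nonneg _
  have hmp : ∀ p ∈ (Finset.range n).offDiag,
      MeasurePreserving (fun ω => (O p.1 ω, O p.2 ω)) Q (μ.prod μ) := fun p hp =>
    measurePreserving_prodMk_of_iid hO hind hlaw (Finset.mem_offDiag.1 hp).2.2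
  have hLp : ∀ p ∈ (Finset.range n).offDiag, MemLp (fun ω => g (O p.1 ω, O p.2 ω)) 2 Q :=
    fun p hp => hg.comp_measurePreserving (hmp p hp)
  have hint : ∀ p ∈ (Finset.range n).offDiag, ∀ q ∈ (Finset.range n).offDiag,
      Integrable (fun ω => g (O p.1 ω, O p.2 ω) * g (O q.1 ω, O q.2 ω)) Q :=
    fun p hp q hq => (hLp p hp).integrable_mul (hLp q hq)
  have hEsq : ∀ p ∈ (Finset.range n).offDiag, ∫ ω, g (O p.1 ω, O p.2 ω) ^ 2 ∂Q = V := by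
    intro p hp
    rw [hV, ← (hmp p hp).map_eq, integral_map (hmp p hp).measurable.aemeasurable]
    rw [(hmp p hp).map_eq]
    exact hg.1.pow 2
  have hE : ∀ p ∈ (Finset.range n).offDiag, ∫ ω, g (O p.1 ω, O p.2 ω) ∂Q = 0 := by
    intro p hp
    rw [← hg0, ← (hmp p hp).map_eq, integral_map (hmp p hp).measurable.aemeasurable]
    rw [(hmp p hp).map_eq]
    exact hg.1
  -- Disjoint index pairs give independent centred factors; otherwise `a * b ≤ (a ^ 2 + b ^ 2) / 2`
  -- bounds the expectation by `V`.
  have hpair : ∀ p ∈ (Finset.range n).offDiag, ∀ q ∈ (Finset.range n).offDiag,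
      ∫ ω, g (O p.1 ω, O p.2 ω) * g (O q.1 ω, O q.2 ω) ∂Q ≤
        if p.1 ≠ q.1 ∧ p.1 ≠ q.2 ∧ p.2 ≠ q.1 ∧ p.2 ≠ q.2 then 0 else V := by
    intro p hp q hq
    split_ifs with hdis
    · have hi := hind.indepFun_prodMk_prodMk hO p.1 p.2 q.1 q.2 hdis.1 hdis.2.1 hdis.2.2.1
        hdis.2.2.2
      have := hi.integral_fun_comp_mul_comp (f := g) (g := g) (hmp p hp).measurable.aemeasurable
        (hmp q hq).measurable.aemeasurable (by rw [(hmp p hp).map_eq]; exact hg.1)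
        (by rw [(hmp q hq).map_eq]; exact hg.1)
      rw [this, hE p hp, zero_mul]
    · have h1 : Integrable (fun ω => g (O p.1 ω, O p.2 ω) ^ 2) Q := (hLp p hp).integrable_sq
      have h2 : Integrable (fun ω => g (O q.1 ω, O q.2 ω) ^ 2) Q := (hLp q hq).integrable_sq
      calc _ ≤ ∫ ω, (g (O p.1 ω, O p.2 ω) ^ 2 + g (O q.1 ω, O q.2 ω) ^ 2) / 2 ∂Q := by
            refine integral_mono (hint p hp q hq) ((h1.add h2).div_const 2) fun ω => ?_
            simp only
            linarith [sq_nonneg (g (O p.1 ω, O p.2 ω) - g (O q.1 ω, O q.2 ω))]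
        _ = V := by
            rw [integral_div, integral_add h1 h2, hEsq p hp, hEsq q hq]
            ring
  simp_rw [sq, Finset.sum_mul_sum]
  rw [integral_finsetSum _ fun p hp => integrable_finsetSum _ fun q hq => hint p hp q hq]
  calc _ = ∑ p ∈ (Finset.range n).offDiag, ∑ q ∈ (Finset.range n).offDiag,
        ∫ ω, g (O p.1 ω, O p.2 ω) * g (O q.1 ω, O q.2 ω) ∂Q :=
        Finset.sum_congr rfl fun p hp => integral_finsetSum _ fun q hq => hint p hp q hq
    _ ≤ ∑ p ∈ (Finset.range n).offDiag, 4 * n * V :=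
        Finset.sum_le_sum fun p hp => (Finset.sum_le_sum fun q hq => hpair p hp q hq).trans
          (sum_offDiag_not_disjoint_le n p hV0)
    _ ≤ 4 * n ^ 3 * V := by
        rw [Finset.sum_const, nsmul_eq_mul]
        have hc : (((Finset.range n).offDiag.card : ℕ) : ℝ) ≤ (n : ℝ) * n := by
          rw [Finset.offDiag_card, Finset.card_range]
          exact_mod_cast Nat.sub_le _ _
        calc _ ≤ ((n : ℝ) * n) * (4 * n * V) := by gcongr
          _ = _ := by ring

/-- **Weak law of large numbers for V-statistics** of order two. -/
theorem tendstoInMeasure_vStatistic [IsProbabilityMeasure μ] (hO : ∀ i, Measurable (O i))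
    (hind : iIndepFun O Q) (hlaw : ∀ i, Q.map (O i) = μ) {g : S → S → ℝ}
    (hg : MemLp (fun z : S × S => g z.1 z.2) 2 (μ.prod μ))
    (hdiag : Integrable (fun o => g o o) μ) :
    TendstoInMeasure Q (fun (n : ℕ) ω => ((n : ℝ) ^ 2)⁻¹ *
        ∑ i ∈ Finset.range n, ∑ j ∈ Finset.range n, g (O i ω) (O j ω)) atTop
      fun _ => ∫ z, g z.1 z.2 ∂(μ.prod μ) := by
  set θ := ∫ z, g z.1 z.2 ∂(μ.prod μ) with hθ
  set g' : S × S → ℝ := fun z => g z.1 z.2 - θ with hg'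
  have hg'Lp : MemLp g' 2 (μ.prod μ) := hg.sub (memLp_const _)
  have hg'0 : ∫ z, g' z ∂(μ.prod μ) = 0 := by
    rw [hg', integral_sub (hg.integrable one_le_two) (integrable_const _)]
    simp [hθ]
  have hinv : Tendsto (fun n : ℕ => (n : ℝ)⁻¹) atTop (𝓝 0) := tendsto_inv_atTop_nhds_zero_nat
  have hoff : TendstoInMeasure Q (fun (n : ℕ) ω => ((n : ℝ) ^ 2)⁻¹ *
      ∑ p ∈ (Finset.range n).offDiag, g' (O p.1 ω, O p.2 ω)) atTop fun _ => (0 : ℝ) := by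
    have hLp : ∀ n : ℕ, MemLp (fun ω => ((n : ℝ) ^ 2)⁻¹ *
        ∑ p ∈ (Finset.range n).offDiag, g' (O p.1 ω, O p.2 ω)) 2 Q := fun n =>
      (memLp_finsetSum _ fun p hp => hg'Lp.comp_measurePreserving
        (measurePreserving_prodMk_of_iid hO hind hlaw (Finset.mem_offDiag.1 hp).2.2)).const_mul _
    refine tendstoInMeasure_zero_of_tendsto_integral_pow 2
      (fun n => (hLp n).integrable_norm_pow two_ne_zero) ?_
    have hlim := hinv.mul_const (4 * ∫ z, g' z ^ 2 ∂(μ.prod μ))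
    rw [zero_mul] at hlim
    refine squeeze_zero (fun n => integral_nonneg fun ω => by positivity) (fun n => ?_) hlim
    simp_rw [norm_mul, mul_pow, Real.norm_eq_abs, sq_abs]
    rw [integral_const_mul]
    rcases Nat.eq_zero_or_pos n with rfl | hn
    · simp
    have hn' : (0 : ℝ) < n := by exact_mod_cast hn
    -- The normalisation `n⁻⁴` against `4 n³` leaves `4 / n`.
    calc _ ≤ (((n : ℝ) ^ 2)⁻¹) ^ 2 * (4 * n ^ 3 * ∫ z, g' z ^ 2 ∂(μ.prod μ)) := by
          gcongr
          exact integral_offDiag_sum_sq_le hO hind hlaw hg'Lp hg'0 n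
      _ = _ := by field_simp
  -- There are only `n` diagonal terms against `n²`, so a first moment suffices.
  have hdg : TendstoInMeasure Q (fun (n : ℕ) ω => ((n : ℝ) ^ 2)⁻¹ *
      ∑ i ∈ Finset.range n, g' (O i ω, O i ω)) atTop fun _ => (0 : ℝ) := by
    have hd : Integrable (fun o => g' (o, o)) μ := hdiag.sub (integrable_const _)
    have hdO : ∀ i, Integrable (fun ω => g' (O i ω, O i ω)) Q := fun i =>
      (⟨hO i, hlaw i⟩ : MeasurePreserving (O i) Q μ).integrable_comp_of_integrable hd
    have hE : ∀ i, ∫ ω, ‖g' (O i ω, O i ω)‖ ∂Q = ∫ o, ‖g' (o, o)‖ ∂μ := fun i => by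
      rw [← hlaw i, integral_map (hO i).aemeasurable]
      rw [hlaw i]; exact hd.1.norm
    have hS : ∀ n : ℕ, Integrable (fun ω => ((n : ℝ) ^ 2)⁻¹ *
        ∑ i ∈ Finset.range n, g' (O i ω, O i ω)) Q := fun n =>
      (integrable_finsetSum _ fun i _ => hdO i).const_mul _
    refine tendstoInMeasure_zero_of_tendsto_integral_pow 1
      (fun n => by simpa only [pow_one] using (hS n).norm) ?_
    have hlim := hinv.mul_const (∫ o, ‖g' (o, o)‖ ∂μ)
    rw [zero_mul] at hlim
    refine squeeze_zero (fun n => integral_nonneg fun ω => by positivity) (fun n => ?_) hlim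
    simp_rw [pow_one, norm_mul]
    rw [integral_const_mul]
    rcases Nat.eq_zero_or_pos n with rfl | hn
    · simp
    have hn' : (0 : ℝ) < n := by exact_mod_cast hn
    calc _ ≤ ‖((n : ℝ) ^ 2)⁻¹‖ * ∑ i ∈ Finset.range n, ∫ o, ‖g' (o, o)‖ ∂μ := by
          gcongr
          rw [← Finset.sum_congr rfl fun i _ => hE i,
            ← integral_finsetSum _ fun i _ => (hdO i).norm]
          refine integral_mono (integrable_finsetSum _ fun i _ => hdO i).norm
            (integrable_finsetSum _ fun i _ => (hdO i).norm) fun ω => norm_sum_le _ _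
      _ = _ := by
          rw [Finset.sum_const, Finset.card_range, nsmul_eq_mul, norm_inv, norm_pow,
            Real.norm_natCast]
          field_simp
  have hsum := hoff.map₂_const hdg (Φ := fun a b : ℝ => a + b + θ) (by fun_prop)
  simp only [add_zero, zero_add] at hsum
  refine hsum.congr' ?_ (ae_eq_refl _)
  filter_upwards [eventually_gt_atTop 0] with n hn
  have hn' : (n : ℝ) ≠ 0 := by exact_mod_cast hn.ne'
  refine Eventually.of_forall fun ω => ?_
  have hsplit : ∑ i ∈ Finset.range n, ∑ j ∈ Finset.range n, g' (O i ω, O j ω) =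
      ∑ p ∈ (Finset.range n).offDiag, g' (O p.1 ω, O p.2 ω) +
        ∑ i ∈ Finset.range n, g' (O i ω, O i ω) := by
    rw [← Finset.sum_product', ← Finset.diag_union_offDiag,
      Finset.sum_union (Finset.disjoint_diag_offDiag _), Finset.sum_diag, add_comm]
  have htot : ∑ i ∈ Finset.range n, ∑ j ∈ Finset.range n, g' (O i ω, O j ω) =
      (∑ i ∈ Finset.range n, ∑ j ∈ Finset.range n, g (O i ω) (O j ω)) - (n : ℝ) ^ 2 * θ := by
    simp only [hg', Finset.sum_sub_distrib, Finset.sum_const, Finset.card_range, nsmul_eq_mul]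
    ring
  simp only
  rw [← mul_add, ← hsplit, htot]
  field_simp
  ring

end VStatistic

/-! ### Conditional expectations given a real feature -/

section CondDistrib

variable {Ω S E : Type*} [MeasurableSpace Ω] {P : Measure Ω} [MeasurableSpace S]
  [NormedAddCommGroup E] {T : Ω → ℝ} {Z : Ω → S} {F : S → E}

lemma integrable_snd_map_prodMk (hT : Measurable T) (hZ : Measurable Z)
    (hF : StronglyMeasurable F) (hFi : Integrable (fun ω => F (Z ω)) P) :
    Integrable (fun z : ℝ × S => F z.2) (P.map fun ω => (T ω, Z ω)) :=
  (integrable_map_measure (hF.comp_measurable measurable_snd).aestronglyMeasurable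
    (hT.prodMk hZ).aemeasurable).2 hFi

variable [IsFiniteMeasure P] [StandardBorelSpace S] [Nonempty S]

lemma ae_integrable_condDistrib (hT : Measurable T) (hZ : Measurable Z)
    (hF : StronglyMeasurable F) (hFi : Integrable (fun ω => F (Z ω)) P) :
    ∀ᵐ s ∂(P.map T), Integrable F (condDistrib Z T P s) :=
  (integrable_snd_map_prodMk hT hZ hF hFi).condDistrib_ae_map hZ.aemeasurable

variable [NormedSpace ℝ E]

/-- Conditioning on `T` under the integral against a bounded function of `T`. -/
lemma integral_smul_condDistrib (hT : Measurable T) (hZ : Measurable Z)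
    (hF : StronglyMeasurable F) (hFi : Integrable (fun ω => F (Z ω)) P) {v : ℝ → ℝ}
    (hv : Measurable v) {C : ℝ} (hvC : ∀ s, |v s| ≤ C) :
    ∫ ω, v (T ω) • F (Z ω) ∂P = ∫ s, v s • ∫ z, F z ∂(condDistrib Z T P s) ∂(P.map T) := by
  have hi : Integrable (fun z : ℝ × S => v z.1 • F z.2) (P.map fun ω => (T ω, Z ω)) :=
    (integrable_snd_map_prodMk hT hZ hF hFi).bdd_smul C
      (hv.comp measurable_fst).aestronglyMeasurable (Eventually.of_forall fun z => hvC z.1)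
  have h1 := integral_map (μ := P) (hT.prodMk hZ).aemeasurable hi.1
  simp only at h1
  rw [← h1]
  rw [← compProd_map_condDistrib hZ.aemeasurable] at hi ⊢
  rw [Measure.integral_compProd hi]
  simp_rw [integral_smul]

variable {p : ℝ → ℝ}

/-- The conditional mean is integrable for the law of `T`; in terms of Lebesgue measure it is its
product with the density that is integrable, and this product is what gets smoothed. -/
lemma integrable_density_smul_condDistrib (hT : Measurable T) (hZ : Measurable Z)
    (hF : StronglyMeasurable F) (hFi : Integrable (fun ω => F (Z ω)) P) (hp : Measurable p)
    (hp0 : ∀ s, 0 ≤ p s) (hpT : P.map T = volume.withDensity fun s => ENNReal.ofReal (p s)) :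
    Integrable fun s => p s • ∫ z, F z ∂(condDistrib Z T P s) := by
  have h := (integrable_snd_map_prodMk hT hZ hF hFi).integral_condDistrib_map hZ.aemeasurable
  rw [hpT, integrable_withDensity_iff_integrable_smul' (by fun_prop)
    (Eventually.of_forall fun _ => ENNReal.ofReal_lt_top)] at h
  simpa only [ENNReal.toReal_ofReal (hp0 _)] using h

/-- Kernel smoothing of a conditional expectation given a feature with a density. -/
theorem ae_tendsto_integral_rescale_condDistrib [CompleteSpace E] (hT : Measurable T)
    (hZ : Measurable Z) (hF : StronglyMeasurable F) (hFi : Integrable (fun ω => F (Z ω)) P)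
    (hp : Measurable p) (hp0 : ∀ s, 0 ≤ p s)
    (hpT : P.map T = volume.withDensity fun s => ENNReal.ofReal (p s))
    {κ ψ : ℝ → ℝ} (hκ : Measurable κ) (hψ : Antitone ψ) (hψ0 : ∀ u, 0 ≤ ψ u)
    (hψi : Integrable (fun u => ψ |u|)) (hκψ : ∀ u, |κ u| ≤ ψ |u|) :
    ∀ᵐ x, Tendsto (fun h => ∫ ω, (1 / h * κ ((T ω - x) / h)) • F (Z ω) ∂P) (𝓝[>] 0)
      (𝓝 ((∫ u, κ u) • p x • ∫ z, F z ∂(condDistrib Z T P x))) := by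
  filter_upwards [ae_tendsto_integral_rescale_smul
    (integrable_density_smul_condDistrib hT hZ hF hFi hp hp0 hpT) hκ hψ hψ0 hψi hκψ] with x hx
  refine hx.congr fun h => ?_
  have hC : ∀ s, |1 / h * κ ((s - x) / h)| ≤ |1 / h| * ψ 0 := fun s => by
    rw [abs_mul]
    gcongr
    exact (hκψ _).trans (hψ (abs_nonneg _))
  have h1 := integral_smul_condDistrib hT hZ hF hFi
    (v := fun s => 1 / h * κ ((s - x) / h)) (by fun_prop) hC
  rw [h1, hpT, integral_withDensity_eq_integral_toReal_smul (by fun_prop)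
    (Eventually.of_forall fun _ => ENNReal.ofReal_lt_top)]
  refine integral_congr_ae (Eventually.of_forall fun s => ?_)
  simp only [ENNReal.toReal_ofReal (hp0 _)]
  rw [smul_comm]

end CondDistrib

/-! ### Kernel-weighted averages of an i.i.d. sample -/

section Smoothing

variable {Ω S H : Type*} [MeasurableSpace Ω] [MeasurableSpace S] [StandardBorelSpace S]
  [Nonempty S] {Q : Measure Ω} [IsProbabilityMeasure Q] {μ : Measure S} [IsProbabilityMeasure μ]
  [NormedAddCommGroup H] [InnerProductSpace ℝ H] [CompleteSpace H]

/-- Kernel-weighted averages of a square integrable function of an i.i.d. sample converge to the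
limit of their means, when the bandwidth tends to zero more slowly than the inverse sample size. -/
theorem ae_tendstoInMeasure_kernel_average {O : ℕ → Ω → S} (hO : ∀ i, Measurable (O i))
    (hind : iIndepFun O Q) (hlaw : ∀ i, Q.map (O i) = μ) {T : S → ℝ} (hT : Measurable T)
    {p : ℝ → ℝ} (hp : Measurable p) (hp0 : ∀ s, 0 ≤ p s)
    (hpT : μ.map T = volume.withDensity fun s => ENNReal.ofReal (p s))
    {κ ψ : ℝ → ℝ} (hκ : Measurable κ) (hψ : Antitone ψ) (hψ0 : ∀ u, 0 ≤ ψ u)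
    (hψi : Integrable (fun u => ψ |u|)) (hκψ : ∀ u, |κ u| ≤ ψ |u|)
    {h : ℕ → ℝ} (hh : Tendsto h atTop (𝓝[>] 0))
    (hnh : Tendsto (fun n : ℕ => (n : ℝ) * h n) atTop atTop)
    {Φ : S → H} (hΦm : StronglyMeasurable Φ) (hΦ : MemLp Φ 2 μ) :
    ∀ᵐ x, ∀ L : H, Tendsto (fun n => ∫ o, (1 / h n * κ ((T o - x) / h n)) • Φ o ∂μ) atTop (𝓝 L) →
      TendstoInMeasure Q (fun (n : ℕ) ω => (n : ℝ)⁻¹ • ∑ i ∈ Finset.range n,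
        (1 / h n * κ ((T (O i ω) - x) / h n)) • Φ (O i ω)) atTop fun _ => L := by
  have hsq : Integrable (fun o => ‖Φ o‖ ^ 2) μ := hΦ.integrable_norm_pow two_ne_zero
  have hψm : Measurable fun u => ψ |u| := hψ.measurable.comp measurable_abs
  -- The approximate identity is used here with profile `ψ |u|` and function `‖Φ‖ ^ 2`. The
  -- exceptional set of `x` depends on these alone, so `L` may be quantified after `x`.
  filter_upwards [ae_tendsto_integral_rescale_condDistrib (Z := id)
    (F := fun o => ‖Φ o‖ ^ 2) hT measurable_id (hΦm.norm.pow 2) hsq hp hp0 hpT hψm hψ hψ0 hψi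
    (fun u => (abs_of_nonneg (hψ0 _)).le)] with x hx L hL
  have hbd : ∀ (n : ℕ) o, ‖1 / h n * κ ((T o - x) / h n)‖ ≤ |1 / h n| * ψ 0 := fun n o => by
    rw [norm_mul, Real.norm_eq_abs, Real.norm_eq_abs]
    gcongr
    exact (hκψ _).trans (hψ (abs_nonneg _))
  have hvm : ∀ n : ℕ, Measurable fun o => 1 / h n * κ ((T o - x) / h n) := fun n => by fun_prop
  have hΞ : ∀ n : ℕ, MemLp (fun o => (1 / h n * κ ((T o - x) / h n)) • Φ o) 2 μ := fun n =>
    hΦ.of_le_mul (c := |1 / h n| * ψ 0) ((hvm n).aestronglyMeasurable.smul hΦ.1)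
      (Eventually.of_forall fun o => by
        rw [norm_smul]
        exact mul_le_mul_of_nonneg_right (hbd n o) (norm_nonneg _))
  refine tendstoInMeasure_average hO hind hlaw hΞ hL ?_
  have hlim := ((tendsto_inv_atTop_zero.comp hnh).const_mul (ψ 0)).mul (hx.comp hh)
  rw [mul_zero, zero_mul] at hlim
  refine squeeze_zero' (Eventually.of_forall fun n =>
    mul_nonneg (by positivity) (integral_nonneg fun o => by positivity)) ?_ hlim
  filter_upwards [(tendsto_nhdsWithin_iff.1 hh).2] with n hn
  have hn : 0 < h n := hn
  simp only [Function.comp_apply]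
  -- From `κ ^ 2 ≤ ψ 0 * ψ |u|`: one factor `1 / h n` is absorbed in the smoothing, the other is
  -- left to pair with `1 / n`.
  have hle : ∫ o, ‖(1 / h n * κ ((T o - x) / h n)) • Φ o‖ ^ 2 ∂μ ≤
      ψ 0 / h n * ∫ o, (1 / h n * ψ |(T o - x) / h n|) • ‖Φ o‖ ^ 2 ∂μ := by
    rw [← integral_const_mul]
    refine integral_mono ((hΞ n).integrable_norm_pow two_ne_zero) ?_ fun o => ?_
    · refine Integrable.const_mul (hsq.bdd_smul
        (φ := fun o => 1 / h n * ψ |(T o - x) / h n|) (1 / h n * ψ 0) ?_ ?_) _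
      · exact ((hψm.comp (by fun_prop)).const_mul _).aestronglyMeasurable
      · refine Eventually.of_forall fun o => ?_
        rw [norm_mul, Real.norm_of_nonneg (by positivity : 0 ≤ 1 / h n),
          Real.norm_of_nonneg (hψ0 _)]
        gcongr
        exact hψ (abs_nonneg _)
    · simp only [smul_eq_mul]
      rw [norm_smul, mul_pow, ← mul_assoc]
      gcongr
      rw [norm_mul, Real.norm_of_nonneg (by positivity : 0 ≤ 1 / h n), Real.norm_eq_abs, sq]
      have h1 := hκψ ((T o - x) / h n)
      have h2 : ψ |(T o - x) / h n| ≤ ψ 0 := hψ (abs_nonneg _)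
      calc _ ≤ (1 / h n * ψ 0) * (1 / h n * ψ |(T o - x) / h n|) := by
            have := h1.trans h2
            have := hψ0 0
            gcongr
        _ = _ := by ring
  calc _ ≤ (n : ℝ)⁻¹ * (ψ 0 / h n * ∫ o, (1 / h n * ψ |(T o - x) / h n|) • ‖Φ o‖ ^ 2 ∂μ) := by
        gcongr
    _ = _ := by
        rw [mul_inv]
        simp only [id]
        ring

end Smoothing

/-! ### Inverse probability weighting -/

namespace WCMMD

open scoped ENNReal

variable {Ω : Type*} [MeasurableSpace Ω] {P : Measure Ω} [IsProbabilityMeasure P] {d : ℕ}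
  {A : Ω → Fin 2} {X : Ω → Fin d → ℝ} {Yp : Fin 2 → Ω → ℝ}

lemma measurable_observed (hA : Measurable A) (hX : Measurable X) (hYp : ∀ a, Measurable (Yp a)) :
    Measurable (observed A X Yp) := by
  have h : Measurable fun ω => ((A ω : ℕ) : ℝ) :=
    (measurable_from_top (f := fun b : Fin 2 => ((b : ℕ) : ℝ))).comp hA
  have h0 := hYp 0
  have h1 := hYp 1
  unfold observed
  fun_prop

lemma observed_outcome {Ω : Type*} {A : Ω → Fin 2} {X : Ω → Fin d → ℝ} {Yp : Fin 2 → Ω → ℝ}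
    {a : Fin 2} {ω : Ω} (h : A ω = a) :
    (observed A X Yp ω).2 = (X ω, Yp a ω) := by
  fin_cases a <;> simp [observed, h]

lemma measurable_propensity : Measurable (propensity P A X) :=
  ((condDistrib A X P).measurable_coe (measurableSet_singleton 1)).ennreal_toReal

lemma measurable_ipw {e : (Fin d → ℝ) → ℝ} (he : Measurable e) (a : Fin 2) :
    Measurable (ipw e a) := by
  have he' : Measurable fun o : Obs d => e o.2.1 := by fun_prop
  refine Measurable.ite (measurable_fst (measurableSet_singleton a)) ?_ measurable_const
  split_ifs
  · exact he'.const_div 1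
  · exact (he'.const_sub 1).const_div 1

/-- The conditional masses of the two arms add up to one, so both weights are reciprocals of the
mass of the received arm and can be treated uniformly. -/
lemma ipw_propensity (a : Fin 2) (o : Obs d) :
    ipw (propensity P A X) a o =
      if o.1 = a then ((condDistrib A X P o.2.1).real {a})⁻¹ else 0 := by
  unfold ipw propensity
  fin_cases a
  · have : ({0} : Set (Fin 2)) = {1}ᶜ := by ext b; fin_cases b <;> simp
    simp only [Fin.zero_eta, Fin.isValue, zero_ne_one, ↓reduceIte, one_div]
    rw [this, probReal_compl_eq_one_sub (measurableSet_singleton _)]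
  · simp

lemma ipw_propensity_nonneg (a : Fin 2) (o : Obs d) : 0 ≤ ipw (propensity P A X) a o := by
  rw [ipw_propensity]
  split_ifs <;> positivity

lemma ipw_zero_mul_ipw_one (e : (Fin d → ℝ) → ℝ) (o : Obs d) : ipw e 0 o * ipw e 1 o = 0 := by
  unfold ipw
  obtain ⟨b, x, y⟩ := o
  fin_cases b <;> simp

/-- Given the covariates, the received treatment does not depend on the potential outcome. -/
lemma lintegral_treated_eq [StandardBorelSpace Ω] (hA : Measurable A) (hX : Measurable X)
    (hYp : ∀ a, Measurable (Yp a))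
    (h_ignorable : CondIndepFun (MeasurableSpace.comap X inferInstance) hX.comap_le
      (fun ω => (Yp 0 ω, Yp 1 ω)) A P) (a : Fin 2) {G : (Fin d → ℝ) × ℝ → ℝ≥0∞}
    (hG : Measurable G) :
    ∫⁻ ω, ({a} : Set (Fin 2)).indicator 1 (A ω) * G (X ω, Yp a ω) ∂P =
      ∫⁻ ω, condDistrib A X P (X ω) {a} * G (X ω, Yp a ω) ∂P := by
  have hind : CondIndepFun (MeasurableSpace.comap X inferInstance) hX.comap_le (Yp a) A P := by
    have hproj : ∀ b : Fin 2, ∃ π : ℝ × ℝ → ℝ, Measurable π ∧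
        Yp b = π ∘ fun ω => (Yp 0 ω, Yp 1 ω) := by
      intro b
      fin_cases b
      · exact ⟨Prod.fst, measurable_fst, rfl⟩
      · exact ⟨Prod.snd, measurable_snd, rfl⟩
    obtain ⟨π, hπ, hYa⟩ := hproj a
    rw [hYa]
    exact h_ignorable.comp hπ measurable_id
  have hXY : Measurable fun ω => (X ω, Yp a ω) := hX.prodMk (hYp a)
  -- Ignorability in kernel form: the conditional law of `A` given `(X, Y^a)` depends on `X` alone,
  -- so the indicator of `A = a` may be replaced by its probability given `X`.
  have hcd := (condIndepFun_iff_condDistrib_prod_ae_eq_prodMkRight hA (hYp a) hX).1 hind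
  rw [condDistrib_ae_eq_iff_measure_eq_compProd _ hA.aemeasurable] at hcd
  have hm : Measurable fun z : ((Fin d → ℝ) × ℝ) × Fin 2 =>
      ({a} : Set (Fin 2)).indicator (1 : Fin 2 → ℝ≥0∞) z.2 * G z.1 :=
    ((measurable_one.indicator (measurableSet_singleton a)).comp measurable_snd).mul
      (hG.comp measurable_fst)
  rw [← lintegral_map (μ := P) (g := fun ω => ((X ω, Yp a ω), A ω)) hm (hXY.prodMk hA), hcd,
    Measure.lintegral_compProd hm, lintegral_map]
  · refine lintegral_congr fun ω => ?_
    simp only [Kernel.prodMkRight_apply]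
    rw [lintegral_mul_const _ (measurable_one.indicator (measurableSet_singleton a)),
      lintegral_indicator_one (measurableSet_singleton a)]
  · exact hm.lintegral_kernel_prod_right'
  · exact hXY

/-- **Inverse probability weighting**: reweighting the observed data by `w^a` gives the joint law of
the covariates and the potential outcome `Y^a`. -/
theorem map_withDensity_ipw [StandardBorelSpace Ω] (hA : Measurable A) (hX : Measurable X)
    (hYp : ∀ a, Measurable (Yp a))
    (h_ignorable : CondIndepFun (MeasurableSpace.comap X inferInstance) hX.comap_le
      (fun ω => (Yp 0 ω, Yp 1 ω)) A P)
    (h_positive : ∀ᵐ x ∂(P.map X), 0 < propensity P A X x ∧ propensity P A X x < 1)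
    (a : Fin 2) :
    ((P.map (observed A X Yp)).withDensity
      fun o => ENNReal.ofReal (ipw (propensity P A X) a o)).map Prod.snd =
      P.map fun ω => (X ω, Yp a ω) := by
  have hobs := measurable_observed hA hX hYp
  have hw := measurable_ipw (measurable_propensity (P := P) (A := A) (X := X)) a
  have hpos : ∀ᵐ ω ∂P, condDistrib A X P (X ω) {a} ≠ 0 := by
    filter_upwards [ae_of_ae_map hX.aemeasurable h_positive] with ω hω h0
    have h1 : (condDistrib A X P (X ω)).real {a} = 0 := by rw [measureReal_def, h0]; rfl
    fin_cases a
    · have : ({1} : Set (Fin 2)) = {0}ᶜ := by ext b; fin_cases b <;> simp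
      have h2 := hω.2
      rw [propensity, this, probReal_compl_eq_one_sub (measurableSet_singleton _)] at h2
      simp only [Fin.zero_eta] at h1
      rw [h1] at h2
      simp at h2
    · exact hω.1.ne' h1
  have hcm : Measurable fun x => condDistrib A X P x {a} :=
    (condDistrib A X P).measurable_coe (measurableSet_singleton a)
  refine Measure.ext_of_lintegral _ fun F hF => ?_
  have hF' : Measurable fun o : Obs d => F o.2 := hF.comp measurable_snd
  rw [lintegral_map hF measurable_snd, lintegral_map hF (hX.prodMk (hYp a)),
    lintegral_withDensity_eq_lintegral_mul _ hw.ennreal_ofReal hF',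
    lintegral_map (hw.ennreal_ofReal.mul hF') hobs]
  have hG : Measurable fun z : (Fin d → ℝ) × ℝ => (condDistrib A X P z.1 {a})⁻¹ * F z :=
    (hcm.comp measurable_fst).inv.mul hF
  calc _ = ∫⁻ ω, ({a} : Set (Fin 2)).indicator 1 (A ω) *
          -- On `A = a` the observed outcome is `Y^a`; off it both sides vanish.
          ((condDistrib A X P (X ω) {a})⁻¹ * F (X ω, Yp a ω)) ∂P := by
        refine lintegral_congr_ae ?_
        filter_upwards [hpos] with ω hω
        simp only [Pi.mul_apply]
        rw [ipw_propensity]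
        by_cases h : A ω = a
        · rw [observed_outcome h, if_pos (show (observed A X Yp ω).1 = a from h),
            Set.indicator_of_mem (show A ω ∈ ({a} : Set (Fin 2)) from h), Pi.one_apply, one_mul,
            measureReal_def, ← ENNReal.toReal_inv, ENNReal.ofReal_toReal (ENNReal.inv_ne_top.2 hω)]
        · rw [if_neg (show ¬ (observed A X Yp ω).1 = a from h),
            Set.indicator_of_notMem (show A ω ∉ ({a} : Set (Fin 2)) from h)]
          simp
    _ = ∫⁻ ω, condDistrib A X P (X ω) {a} *
          ((condDistrib A X P (X ω) {a})⁻¹ * F (X ω, Yp a ω)) ∂P :=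
        lintegral_treated_eq hA hX hYp h_ignorable a hG
    _ = ∫⁻ ω, F (X ω, Yp a ω) ∂P := by
        refine lintegral_congr_ae ?_
        filter_upwards [hpos] with ω hω
        rw [← mul_assoc, ENNReal.mul_inv_cancel hω (measure_ne_top _ _), one_mul]

variable {E : Type*} [NormedAddCommGroup E] [NormedSpace ℝ E]

/-- Transfers integrability between the observed data, where it is assumed, and the potential
outcome, where it is needed. -/
lemma integrable_ipw_smul_iff [StandardBorelSpace Ω] (hA : Measurable A) (hX : Measurable X)
    (hYp : ∀ a, Measurable (Yp a))
    (h_ignorable : CondIndepFun (MeasurableSpace.comap X inferInstance) hX.comap_le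
      (fun ω => (Yp 0 ω, Yp 1 ω)) A P)
    (h_positive : ∀ᵐ x ∂(P.map X), 0 < propensity P A X x ∧ propensity P A X x < 1)
    (a : Fin 2) {F : (Fin d → ℝ) × ℝ → E} (hF : StronglyMeasurable F) :
    Integrable (fun o => ipw (propensity P A X) a o • F o.2) (P.map (observed A X Yp)) ↔
      Integrable (fun ω => F (X ω, Yp a ω)) P := by
  have hw := measurable_ipw (measurable_propensity (P := P) (A := A) (X := X)) a
  have h1 := integrable_map_measure (μ := P) hF.aestronglyMeasurable
    (hX.prodMk (hYp a)).aemeasurable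
  rw [← map_withDensity_ipw hA hX hYp h_ignorable h_positive a,
    integrable_map_measure hF.aestronglyMeasurable measurable_snd.aemeasurable,
    integrable_withDensity_iff_integrable_smul' hw.ennreal_ofReal
    (Eventually.of_forall fun _ => ENNReal.ofReal_lt_top)] at h1
  simpa only [ENNReal.toReal_ofReal (ipw_propensity_nonneg _ _), Function.comp_apply,
    Function.comp_def] using h1

lemma integral_ipw_smul [StandardBorelSpace Ω] (hA : Measurable A) (hX : Measurable X)
    (hYp : ∀ a, Measurable (Yp a))
    (h_ignorable : CondIndepFun (MeasurableSpace.comap X inferInstance) hX.comap_le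
      (fun ω => (Yp 0 ω, Yp 1 ω)) A P)
    (h_positive : ∀ᵐ x ∂(P.map X), 0 < propensity P A X x ∧ propensity P A X x < 1)
    (a : Fin 2) {F : (Fin d → ℝ) × ℝ → E} (hF : StronglyMeasurable F) :
    ∫ o, ipw (propensity P A X) a o • F o.2 ∂(P.map (observed A X Yp)) =
      ∫ ω, F (X ω, Yp a ω) ∂P := by
  have hw := measurable_ipw (measurable_propensity (P := P) (A := A) (X := X)) a
  rw [← integral_map (μ := P) (hX.prodMk (hYp a)).aemeasurable hF.aestronglyMeasurable,
    ← map_withDensity_ipw hA hX hYp h_ignorable h_positive a,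
    integral_map measurable_snd.aemeasurable hF.aestronglyMeasurable,
    integral_withDensity_eq_integral_toReal_smul hw.ennreal_ofReal
    (Eventually.of_forall fun _ => ENNReal.ofReal_lt_top)]
  simp only [ENNReal.toReal_ofReal (ipw_propensity_nonneg _ _)]

/-- Inverse probability weighting in the presence of a weight that depends on one feature. -/
lemma integral_feature_smul_ipw_smul [StandardBorelSpace Ω] (hA : Measurable A) (hX : Measurable X)
    (hYp : ∀ a, Measurable (Yp a))
    (h_ignorable : CondIndepFun (MeasurableSpace.comap X inferInstance) hX.comap_le
      (fun ω => (Yp 0 ω, Yp 1 ω)) A P)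
    (h_positive : ∀ᵐ x ∂(P.map X), 0 < propensity P A X x ∧ propensity P A X x < 1)
    (m : Fin d) (a : Fin 2) {g : ℝ → E} (hg : StronglyMeasurable g) {v : ℝ → ℝ}
    (hv : Measurable v) :
    ∫ o, v (o.2.1 m) • ipw (propensity P A X) a o • g o.2.2 ∂(P.map (observed A X Yp)) =
      ∫ ω, v (X ω m) • g (Yp a ω) ∂P := by
  rw [← integral_ipw_smul hA hX hYp h_ignorable h_positive a
    (F := fun z => v (z.1 m) • g z.2)]
  · simp_rw [smul_comm (v _)]
  · exact (hv.comp ((measurable_pi_apply m).comp measurable_fst)).stronglyMeasurable.smul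
      (hg.comp_measurable measurable_snd)

/-! ### The estimator -/

/-- With weights proportional to `c i * w^a`, the estimator is a normalized quadratic form in the
combined kernel. -/
lemma estimator_eq {d : ℕ} (e : (Fin d → ℝ) → ℝ) {kY : ℝ → ℝ → ℝ} (hsymm : ∀ s t, kY s t = kY t s)
    (n : ℕ) (o : ℕ → Obs d) (c : ℕ → ℝ) (C : ℝ) :
    estimator kY n o (fun a i => c i / C * ipw e a (o i)) =
      (∑ i ∈ Finset.range n, ∑ j ∈ Finset.range n,
        c i * c j * combinedKernel e kY (o i) (o j)) / C ^ 2 := by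
  -- Symmetry of `kY` splits the doubled cross sum into the two mixed terms of `K`.
  have hswap : ∑ i ∈ Finset.range n, ∑ j ∈ Finset.range n,
      c i / C * ipw e 0 (o i) * (c j / C * ipw e 1 (o j)) * kY (o i).2.2 (o j).2.2 =
      ∑ i ∈ Finset.range n, ∑ j ∈ Finset.range n,
      c i / C * ipw e 1 (o i) * (c j / C * ipw e 0 (o j)) * kY (o i).2.2 (o j).2.2 := by
    rw [Finset.sum_comm]
    refine Finset.sum_congr rfl fun i _ => Finset.sum_congr rfl fun j _ => ?_
    rw [hsymm (o j).2.2]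
    ring
  rw [estimator, two_mul]
  nth_rewrite 2 [hswap]
  simp only [← Finset.sum_add_distrib, ← Finset.sum_sub_distrib, Finset.sum_div]
  refine Finset.sum_congr rfl fun i _ => Finset.sum_congr rfl fun j _ => ?_
  rw [combinedKernel]
  ring

/-- Nobody is in both arms, so the mixed products vanish; for a positive semidefinite kernel the
diagonal controls each arm separately. -/
lemma combinedKernel_self {d : ℕ} (e : (Fin d → ℝ) → ℝ) (kY : ℝ → ℝ → ℝ) (o : Obs d) :
    combinedKernel e kY o o = (ipw e 0 o ^ 2 + ipw e 1 o ^ 2) * kY o.2.2 o.2.2 := by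
  have := ipw_zero_mul_ipw_one e o
  rw [combinedKernel]
  linear_combination (-2 * kY o.2.2 o.2.2) * this

section Feature

variable {H : Type*} [NormedAddCommGroup H] [InnerProductSpace ℝ H] {φ : ℝ → H}
  {kY : ℝ → ℝ → ℝ}

/-- The coefficient factors as `(w¹ - w⁰)(w¹' - w⁰')`, so quadratic forms in `K` are squared norms
of sums of features. -/
lemma combinedKernel_eq_inner {d : ℕ} (e : (Fin d → ℝ) → ℝ)
    (hφ : ∀ s t, inner ℝ (φ s) (φ t) = kY s t) (o o' : Obs d) :
    combinedKernel e kY o o' = inner ℝ ((ipw e 1 o - ipw e 0 o) • φ o.2.2)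
      ((ipw e 1 o' - ipw e 0 o') • φ o'.2.2) := by
  rw [real_inner_smul_left, real_inner_smul_right, hφ, combinedKernel]
  ring

/-- The squared maximum mean discrepancy is the squared distance of the mean embeddings. -/
lemma mmdSq_eq_norm_sq [CompleteSpace H] (hφ : ∀ s t, inner ℝ (φ s) (φ t) = kY s t)
    {μ ν : Measure ℝ} [IsFiniteMeasure μ] [IsFiniteMeasure ν] (hμ : Integrable φ μ)
    (hν : Integrable φ ν) :
    mmdSq kY μ ν = ‖(∫ y, φ y ∂ν) - ∫ y, φ y ∂μ‖ ^ 2 := by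
  have key : ∀ {μ ν : Measure ℝ} [IsFiniteMeasure μ] [IsFiniteMeasure ν], Integrable φ μ →
      Integrable φ ν → ∫ z, kY z.1 z.2 ∂(μ.prod ν) = inner ℝ (∫ y, φ y ∂μ) (∫ y, φ y ∂ν) := by
    intro μ ν _ _ hμ hν
    simp_rw [← hφ]
    exact integral_prod_bilin (𝕜 := ℝ) (innerSL ℝ) hμ hν
  rw [mmdSq, key hμ hμ, key hν hν, key hμ hν, norm_sub_sq_real, real_inner_self_eq_norm_sq,
    real_inner_self_eq_norm_sq, real_inner_comm]
  ring

end Feature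

variable {kY : ℝ → ℝ → ℝ}

/-- Its square is one of the two nonnegative terms of `K(o, o)`, and `L²` lies in `L¹` for a finite
measure. -/
lemma integrable_ipw_mul_sqrt_kernel (hkY_meas : Measurable fun z : ℝ × ℝ => kY z.1 z.2)
    (hkY0 : ∀ y, 0 ≤ kY y y) {μ : Measure (Obs d)} [IsFiniteMeasure μ]
    (hdiag : Integrable (fun o => combinedKernel (propensity P A X) kY o o) μ)
    (a : Fin 2) :
    Integrable (fun o => ipw (propensity P A X) a o * √(kY o.2.2 o.2.2)) μ := by
  have hw : ∀ a, Measurable (ipw (propensity P A X) a) :=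
    measurable_ipw (measurable_propensity (P := P) (A := A) (X := X))
  have hk : Measurable fun o : Obs d => kY o.2.2 o.2.2 :=
    hkY_meas.comp (by fun_prop : Measurable fun o : Obs d => (o.2.2, o.2.2))
  have hm : Measurable fun o => ipw (propensity P A X) a o * √(kY o.2.2 o.2.2) :=
    (hw a).mul hk.sqrt
  refine MemLp.integrable (q := 2) one_le_two ?_
  rw [memLp_two_iff_integrable_sq hm.aestronglyMeasurable]
  refine hdiag.mono' (hm.pow_const 2).aestronglyMeasurable (Eventually.of_forall fun o => ?_)
  rw [Real.norm_of_nonneg (sq_nonneg _), mul_pow, Real.sq_sqrt (hkY0 _), combinedKernel_self]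
  refine mul_le_mul_of_nonneg_right ?_ (hkY0 _)
  fin_cases a
  · exact le_add_of_nonneg_right (sq_nonneg _)
  · exact le_add_of_nonneg_left (sq_nonneg _)

variable [StandardBorelSpace Ω]

/-- Since `√(kY y y)` is the norm of the feature of `y`, this is what makes the mean embedding of
`Y^a` exist. -/
lemma integrable_sqrt_kernel_potential (hA : Measurable A) (hX : Measurable X)
    (hYp : ∀ a, Measurable (Yp a))
    (h_ignorable : CondIndepFun (MeasurableSpace.comap X inferInstance) hX.comap_le
      (fun ω => (Yp 0 ω, Yp 1 ω)) A P)
    (h_positive : ∀ᵐ x ∂(P.map X), 0 < propensity P A X x ∧ propensity P A X x < 1)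
    (hkY_meas : Measurable fun z : ℝ × ℝ => kY z.1 z.2) (hkY0 : ∀ y, 0 ≤ kY y y)
    (hdiag : Integrable (fun o => combinedKernel (propensity P A X) kY o o)
      (P.map (observed A X Yp)))
    (a : Fin 2) : Integrable (fun ω => √(kY (Yp a ω) (Yp a ω))) P := by
  have hk : Measurable fun z : (Fin d → ℝ) × ℝ => √(kY z.2 z.2) :=
    (hkY_meas.comp (by fun_prop : Measurable fun z : (Fin d → ℝ) × ℝ => (z.2, z.2))).sqrt
  exact (integrable_ipw_smul_iff hA hX hYp h_ignorable h_positive a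
    (F := fun z => √(kY z.2 z.2)) hk.stronglyMeasurable).1
    (integrable_ipw_mul_sqrt_kernel hkY_meas hkY0 hdiag a)

/-! ### Indicator weights -/

/-- An atom avoids every null set; so almost sure facts about conditional laws hold at `x` itself.
-/
lemma of_ae_of_measure_singleton_ne_zero {S : Type*} [MeasurableSpace S] {ν : Measure S}
    {q : S → Prop} (h : ∀ᵐ s ∂ν, q s) {x : S} (hx : ν {x} ≠ 0) : q x := by
  by_contra hn
  exact hx (measure_mono_null (Set.singleton_subset_iff.2 hn) h)

/-- The mean of an inverse probability weighted function of the outcome over the observations with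
`X_m = x`. -/
lemma integral_indicator_ipw (hA : Measurable A) (hX : Measurable X)
    (hYp : ∀ a, Measurable (Yp a))
    (h_ignorable : CondIndepFun (MeasurableSpace.comap X inferInstance) hX.comap_le
      (fun ω => (Yp 0 ω, Yp 1 ω)) A P)
    (h_positive : ∀ᵐ x ∂(P.map X), 0 < propensity P A X x ∧ propensity P A X x < 1)
    (m : Fin d) (x : ℝ) (a : Fin 2) {g : ℝ → ℝ} (hg : Measurable g)
    (hgi : Integrable (fun ω => g (Yp a ω)) P) :
    ∫ o, (if o.2.1 m = x then 1 else 0) * ipw (propensity P A X) a o * g o.2.2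
        ∂(P.map (observed A X Yp)) =
      (P.map fun ω => X ω m).real {x} *
        ∫ y, g y ∂(condDistrib (Yp a) (fun ω => X ω m) P x) := by
  have hv : Measurable fun s : ℝ => if s = x then (1 : ℝ) else 0 :=
    Measurable.ite (measurableSet_singleton x) measurable_const measurable_const
  have hT : Measurable fun ω => X ω m := (measurable_pi_apply m).comp hX
  have h1 := integral_feature_smul_ipw_smul hA hX hYp h_ignorable h_positive m a
    hg.stronglyMeasurable hv
  have h2 := integral_smul_condDistrib hT (hYp a) hg.stronglyMeasurable hgi hv (C := 1)
    (fun s => by split_ifs <;> simp)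
  simp only [smul_eq_mul, ← mul_assoc] at h1 h2
  rw [h1, h2]
  have h3 : (fun s => (if s = x then (1 : ℝ) else 0) *
      ∫ y, g y ∂(condDistrib (Yp a) (fun ω => X ω m) P s)) =
      ({x} : Set ℝ).indicator fun s => ∫ y, g y ∂(condDistrib (Yp a) (fun ω => X ω m) P s) := by
    ext s
    by_cases hs : s = x <;> simp [hs]
  rw [h3, integral_indicator (measurableSet_singleton x), integral_singleton, smul_eq_mul]

/-- The mean over two independent observations of a cross term of the combined kernel. -/
lemma integral_indicator_ipw_prod (hA : Measurable A) (hX : Measurable X)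
    (hYp : ∀ a, Measurable (Yp a))
    (h_ignorable : CondIndepFun (MeasurableSpace.comap X inferInstance) hX.comap_le
      (fun ω => (Yp 0 ω, Yp 1 ω)) A P)
    (h_positive : ∀ᵐ x ∂(P.map X), 0 < propensity P A X x ∧ propensity P A X x < 1)
    (hkY_meas : Measurable fun z : ℝ × ℝ => kY z.1 z.2) (hkY0 : ∀ y, 0 ≤ kY y y)
    (hkY_le : ∀ s t, |kY s t| ≤ √(kY s s) * √(kY t t))
    (hdiag : Integrable (fun o => combinedKernel (propensity P A X) kY o o)
      (P.map (observed A X Yp)))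
    (m : Fin d) {x : ℝ} (hx : P.map (fun ω => X ω m) {x} ≠ 0) (a b : Fin 2) :
    Integrable (fun z : Obs d × Obs d =>
      ((if z.1.2.1 m = x then 1 else 0) * ipw (propensity P A X) a z.1) *
        ((if z.2.2.1 m = x then 1 else 0) * ipw (propensity P A X) b z.2) * kY z.1.2.2 z.2.2.2)
      ((P.map (observed A X Yp)).prod (P.map (observed A X Yp))) ∧
    ∫ z : Obs d × Obs d,
      ((if z.1.2.1 m = x then 1 else 0) * ipw (propensity P A X) a z.1) *
        ((if z.2.2.1 m = x then 1 else 0) * ipw (propensity P A X) b z.2) * kY z.1.2.2 z.2.2.2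
      ∂((P.map (observed A X Yp)).prod (P.map (observed A X Yp))) =
      (P.map fun ω => X ω m).real {x} ^ 2 *
        ∫ z, kY z.1 z.2 ∂((condDistrib (Yp a) (fun ω => X ω m) P x).prod
          (condDistrib (Yp b) (fun ω => X ω m) P x)) := by
  have hobs := measurable_observed hA hX hYp
  have : IsProbabilityMeasure (P.map (observed A X Yp)) :=
    Measure.isProbabilityMeasure_map hobs.aemeasurable
  set μ := P.map (observed A X Yp) with hμ
  set e := propensity P A X with he
  have hw : ∀ a, Measurable (ipw e a) :=
    measurable_ipw (measurable_propensity (P := P) (A := A) (X := X))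
  have hT : Measurable fun ω => X ω m := (measurable_pi_apply m).comp hX
  have hv : Measurable fun o : Obs d => if o.2.1 m = x then (1 : ℝ) else 0 :=
    Measurable.ite (measurableSet_eq_fun (by fun_prop) measurable_const) measurable_const
      measurable_const
  have hsq : Measurable fun y => √(kY y y) :=
    (hkY_meas.comp (measurable_id.prodMk measurable_id)).sqrt
  have hws := fun a => integrable_ipw_mul_sqrt_kernel (P := P) (A := A) (X := X) hkY_meas hkY0
    hdiag a
  have hYs := fun a => integrable_sqrt_kernel_potential hA hX hYp h_ignorable h_positive hkY_meas
    hkY0 hdiag a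
  have hcs : ∀ a, Integrable (fun y => √(kY y y)) (condDistrib (Yp a) (fun ω => X ω m) P x) :=
    fun a => of_ae_of_measure_singleton_ne_zero
      (ae_integrable_condDistrib hT (hYp a) hsq.stronglyMeasurable (hYs a)) hx
  have hint : Integrable (fun z : Obs d × Obs d =>
      ((if z.1.2.1 m = x then 1 else 0) * ipw e a z.1) *
        ((if z.2.2.1 m = x then 1 else 0) * ipw e b z.2) * kY z.1.2.2 z.2.2.2)
      (μ.prod μ) := by
    refine ((hws a).mul_prod (hws b)).mono' ?_ (Eventually.of_forall fun z => ?_)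
    · have h1 : Measurable fun z : Obs d × Obs d => kY z.1.2.2 z.2.2.2 :=
        hkY_meas.comp (by fun_prop : Measurable fun z : Obs d × Obs d => (z.1.2.2, z.2.2.2))
      exact ((((hv.mul (hw a)).comp measurable_fst).mul
        ((hv.mul (hw b)).comp measurable_snd)).mul h1).aestronglyMeasurable
    · have hva : ∀ a (o : Obs d), |(if o.2.1 m = x then 1 else 0) * ipw e a o| ≤ ipw e a o := by
        intro a o
        have := ipw_propensity_nonneg (P := P) (A := A) (X := X) a o
        split_ifs
        · rw [one_mul, abs_of_nonneg this]
        · simpa using this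
      have hwa := ipw_propensity_nonneg (P := P) (A := A) (X := X) a z.1
      have hwb := ipw_propensity_nonneg (P := P) (A := A) (X := X) b z.2
      rw [Real.norm_eq_abs, abs_mul, abs_mul]
      calc _ ≤ ipw e a z.1 * ipw e b z.2 * (√(kY z.1.2.2 z.1.2.2) * √(kY z.2.2.2 z.2.2.2)) := by
            gcongr
            · exact hva a z.1
            · exact hva b z.2
            · exact hkY_le _ _
        _ = _ := by ring
  refine ⟨hint, ?_⟩
  have hkint : Integrable (fun z : ℝ × ℝ => kY z.1 z.2)
      ((condDistrib (Yp a) (fun ω => X ω m) P x).prod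
        (condDistrib (Yp b) (fun ω => X ω m) P x)) :=
    ((hcs a).mul_prod (hcs b)).mono' hkY_meas.aestronglyMeasurable
      (Eventually.of_forall fun z => hkY_le _ _)
  set c := (P.map fun ω => X ω m).real {x} with hc
  set ν := condDistrib (Yp b) (fun ω => X ω m) P x with hν
  -- Fubini: with the first outcome frozen at `y`, weighting in the second observation gives one
  -- factor `c`. The result is a function of the first outcome, and weighting again gives the other.
  have hinner : ∀ y, ∫ o, (if o.2.1 m = x then 1 else 0) * ipw e b o * kY y o.2.2 ∂μ =
      c * ∫ t, kY y t ∂ν := by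
    intro y
    refine integral_indicator_ipw hA hX hYp h_ignorable h_positive m x b
      (hkY_meas.comp (measurable_const.prodMk measurable_id)) ?_
    refine ((hYs b).const_mul √(kY y y)).mono' ?_ (Eventually.of_forall fun ω => hkY_le _ _)
    exact (hkY_meas.comp (measurable_const.prodMk (hYp b))).aestronglyMeasurable
  have hgm : Measurable fun y => ∫ t, kY y t ∂ν :=
    (hkY_meas.stronglyMeasurable.integral_prod_right (ν := ν)).measurable
  have hgi : Integrable (fun ω => ∫ t, kY (Yp a ω) t ∂ν) P := by
    refine ((hYs a).mul_const (∫ t, √(kY t t) ∂ν)).mono'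
      (hgm.comp (hYp a)).aestronglyMeasurable (Eventually.of_forall fun ω => ?_)
    rw [← integral_const_mul]
    exact norm_integral_le_of_norm_le ((hcs b).const_mul _)
      (Eventually.of_forall fun t => hkY_le _ _)
  rw [integral_prod _ hint, integral_prod _ hkint]
  have h1 : ∀ o : Obs d, ∫ o' : Obs d, ((if o.2.1 m = x then 1 else 0) * ipw e a o) *
      ((if o'.2.1 m = x then 1 else 0) * ipw e b o') * kY o.2.2 o'.2.2 ∂μ =
      c * ((if o.2.1 m = x then 1 else 0) * ipw e a o * ∫ t, kY o.2.2 t ∂ν) := by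
    intro o
    simp_rw [mul_assoc ((if o.2.1 m = x then 1 else 0) * ipw e a o)]
    rw [integral_const_mul, hinner]
    ring
  simp only [h1]
  rw [integral_const_mul, integral_indicator_ipw hA hX hYp h_ignorable h_positive m x a hgm hgi]
  ring

/-- The four terms of `K` are integrated separately; the two mixed ones agree by symmetry and form
the factor `2` in the discrepancy. -/
lemma integral_indicator_combinedKernel (hA : Measurable A) (hX : Measurable X)
    (hYp : ∀ a, Measurable (Yp a))
    (h_ignorable : CondIndepFun (MeasurableSpace.comap X inferInstance) hX.comap_le
      (fun ω => (Yp 0 ω, Yp 1 ω)) A P)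
    (h_positive : ∀ᵐ x ∂(P.map X), 0 < propensity P A X x ∧ propensity P A X x < 1)
    (hkY_meas : Measurable fun z : ℝ × ℝ => kY z.1 z.2) (hsymm : ∀ s t, kY s t = kY t s)
    (hkY0 : ∀ y, 0 ≤ kY y y) (hkY_le : ∀ s t, |kY s t| ≤ √(kY s s) * √(kY t t))
    (hdiag : Integrable (fun o => combinedKernel (propensity P A X) kY o o)
      (P.map (observed A X Yp)))
    (m : Fin d) {x : ℝ} (hx : P.map (fun ω => X ω m) {x} ≠ 0) :
    ∫ z : Obs d × Obs d, (if z.1.2.1 m = x then 1 else 0) * (if z.2.2.1 m = x then 1 else 0) *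
        combinedKernel (propensity P A X) kY z.1 z.2
      ∂((P.map (observed A X Yp)).prod (P.map (observed A X Yp))) =
      (P.map fun ω => X ω m).real {x} ^ 2 * condMMDSq P X Yp kY m x := by
  have key := integral_indicator_ipw_prod hA hX hYp h_ignorable h_positive hkY_meas hkY0 hkY_le
    hdiag m hx
  have hswap : ∫ z, kY z.1 z.2 ∂((condDistrib (Yp 1) (fun ω => X ω m) P x).prod
        (condDistrib (Yp 0) (fun ω => X ω m) P x)) =
      ∫ z, kY z.1 z.2 ∂((condDistrib (Yp 0) (fun ω => X ω m) P x).prod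
        (condDistrib (Yp 1) (fun ω => X ω m) P x)) := by
    rw [← integral_prod_swap]
    refine integral_congr_ae (Eventually.of_forall fun z => ?_)
    exact hsymm _ _
  have hi := ((key 0 0).1.add (key 1 1).1)
  have hi' := hi.sub (key 0 1).1
  have hsplit := integral_sub hi' (key 1 0).1
  have hsplit2 := integral_sub hi (key 0 1).1
  have hsplit3 := integral_add (key 0 0).1 (key 1 1).1
  simp only [Pi.add_apply, Pi.sub_apply] at hsplit hsplit2 hsplit3
  rw [hsplit2, hsplit3, (key 0 0).2, (key 1 1).2, (key 0 1).2, (key 1 0).2, hswap] at hsplit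
  rw [condMMDSq, mmdSq]
  calc _ = _ := by
        refine integral_congr_ae (Eventually.of_forall fun z => ?_)
        simp only
        rw [combinedKernel]
        ring
    _ = _ := hsplit
    _ = _ := by ring

/-- Consistency of the estimator with indicator weights. -/
theorem tendstoInMeasure_discrete (hA : Measurable A) (hX : Measurable X)
    (hYp : ∀ a, Measurable (Yp a)) {Ω' : Type*} [MeasurableSpace Ω'] {Q : Measure Ω'}
    [IsProbabilityMeasure Q] {O : ℕ → Ω' → Obs d} (hO : ∀ i, Measurable (O i))
    (hO_indep : iIndepFun O Q) (hO_law : ∀ i, Q.map (O i) = P.map (observed A X Yp))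
    (hkY_meas : Measurable (fun z : ℝ × ℝ => kY z.1 z.2)) (hkY_pos : (Matrix.of kY).PosSemidef)
    (h_ignorable : CondIndepFun (MeasurableSpace.comap X inferInstance) hX.comap_le
      (fun ω => (Yp 0 ω, Yp 1 ω)) A P)
    (h_positive : ∀ᵐ x ∂(P.map X), 0 < propensity P A X x ∧ propensity P A X x < 1)
    (h_sqInt : SquareIntegrable (P.map (observed A X Yp)) (combinedKernel (propensity P A X) kY))
    (m : Fin d) {x : ℝ} (hx : P {ω | X ω m = x} ≠ 0) :
    TendstoInMeasure Q
      (fun n ω' => estimator kY n (fun i => O i ω')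
        (discreteWeight (propensity P A X) m x n (fun i => O i ω')))
      atTop (fun _ => condMMDSq P X Yp kY m x) := by
  obtain ⟨H, _, _, _, φ, hφ⟩ := hkY_pos.exists_featureMap
  have hsymm := hkY_pos.kernel_symm
  have hkY0 : ∀ y, 0 ≤ kY y y := fun y => by
    rw [← norm_sq_featureMap hφ]; positivity
  have hobs := measurable_observed hA hX hYp
  have : IsProbabilityMeasure (P.map (observed A X Yp)) :=
    Measure.isProbabilityMeasure_map hobs.aemeasurable
  have hT : Measurable fun ω => X ω m := (measurable_pi_apply m).comp hX
  have hTo : Measurable fun o : Obs d => o.2.1 m := by fun_prop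
  have hx' : P.map (fun ω => X ω m) {x} ≠ 0 := by
    rwa [Measure.map_apply hT (measurableSet_singleton x)]
  have hmap : (P.map (observed A X Yp)).map (fun o => o.2.1 m) = P.map fun ω => X ω m := by
    rw [Measure.map_map hTo hobs]
    rfl
  set μ := P.map (observed A X Yp) with hμ
  set v : Obs d → ℝ := fun o => if o.2.1 m = x then 1 else 0 with hv
  have hvm : Measurable v :=
    Measurable.ite (measurableSet_eq_fun hTo measurable_const) measurable_const measurable_const
  have hv1 : ∀ o, ‖v o‖ ≤ 1 := fun o => by
    simp only [hv]
    split_ifs <;> simp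
  set c := (P.map fun ω => X ω m).real {x} with hc
  have hc0 : c ≠ 0 := (measureReal_ne_zero_iff (measure_ne_top _ _)).2 hx'
  have hvv : ∀ o o', ‖v o * v o'‖ ≤ 1 := fun o o' => by
    rw [norm_mul]
    exact mul_le_one₀ (hv1 o) (norm_nonneg _) (hv1 o')
  -- Localising `K` by indicators bounded by `1` preserves both integrability conditions.
  have hnum := tendstoInMeasure_vStatistic hO hO_indep hO_law
    (g := fun o o' => v o * v o' * combinedKernel (propensity P A X) kY o o') ?_ ?_
  rotate_left
  · refine h_sqInt.memLp.of_le ?_ (Eventually.of_forall fun z => ?_)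
    · exact (((hvm.comp measurable_fst).mul (hvm.comp measurable_snd)).aestronglyMeasurable).mul
        h_sqInt.memLp.1
    · rw [norm_mul]
      exact mul_le_of_le_one_left (norm_nonneg _) (hvv _ _)
  · exact h_sqInt.diag.bdd_mul (c := 1) (hvm.mul hvm).aestronglyMeasurable
      (Eventually.of_forall fun o => hvv o o)
  have hθ := integral_indicator_combinedKernel hA hX hYp h_ignorable h_positive hkY_meas hsymm hkY0
    (abs_kernel_le hφ) h_sqInt.diag m hx'
  have hvint : ∫ o, v o ∂μ = c := by
    have : v = ((fun o : Obs d => o.2.1 m) ⁻¹' {x}).indicator 1 := by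
      ext o
      by_cases h : o.2.1 m = x <;> simp [hv, h]
    rw [this, integral_indicator_one (hTo (measurableSet_singleton x)), hc, ← hmap,
      map_measureReal_apply hTo (measurableSet_singleton x)]
  have hvLp : MemLp v 2 μ := MemLp.of_bound hvm.aestronglyMeasurable 1 (Eventually.of_forall hv1)
  have hden := tendstoInMeasure_average hO hO_indep hO_law (Ξ := fun _ => v) (fun _ => hvLp)
    tendsto_const_nhds (by
      have := (tendsto_inv_atTop_nhds_zero_nat (𝕜 := ℝ)).mul_const (∫ o, ‖v o‖ ^ 2 ∂μ)
      rwa [zero_mul] at this)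
  rw [hvint] at hden
  have hratio := hnum.map₂_const hden (Φ := fun a b : ℝ => a / b ^ 2)
    (ContinuousAt.div (by fun_prop) (by fun_prop) (pow_ne_zero 2 hc0))
  have hval : (∫ z : Obs d × Obs d, v z.1 * v z.2 *
      combinedKernel (propensity P A X) kY z.1 z.2 ∂(μ.prod μ)) / c ^ 2 =
      condMMDSq P X Yp kY m x := by
    rw [hv, hθ]
    exact mul_div_cancel_left₀ _ (pow_ne_zero 2 hc0)
  rw [hval] at hratio
  refine hratio.congr' ?_ (ae_eq_refl _)
  filter_upwards [eventually_gt_atTop 0] with n hn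
  have hn' : (n : ℝ) ≠ 0 := by exact_mod_cast hn.ne'
  refine Eventually.of_forall fun ω' => ?_
  have hest := estimator_eq (propensity P A X) hsymm n (fun i => O i ω') (fun i => v (O i ω'))
    (∑ l ∈ Finset.range n, v (O l ω'))
  simp only [smul_eq_mul]
  rw [mul_pow, inv_pow, mul_div_mul_left _ _ (inv_ne_zero (pow_ne_zero 2 hn')), ← hest]
  rfl

/-! ### Kernel-smoothing weights -/

/-- Consistency of the estimator with kernel-smoothing weights. -/
theorem ae_tendstoInMeasure_smooth (hA : Measurable A) (hX : Measurable X)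
    (hYp : ∀ a, Measurable (Yp a)) {Ω' : Type*} [MeasurableSpace Ω'] {Q : Measure Ω'}
    [IsProbabilityMeasure Q] {O : ℕ → Ω' → Obs d} (hO : ∀ i, Measurable (O i))
    (hO_indep : iIndepFun O Q) (hO_law : ∀ i, Q.map (O i) = P.map (observed A X Yp))
    (hkY_cont : Continuous (fun z : ℝ × ℝ => kY z.1 z.2)) (hkY_pos : (Matrix.of kY).PosSemidef)
    (h_ignorable : CondIndepFun (MeasurableSpace.comap X inferInstance) hX.comap_le
      (fun ω => (Yp 0 ω, Yp 1 ω)) A P)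
    (h_positive : ∀ᵐ x ∂(P.map X), 0 < propensity P A X x ∧ propensity P A X x < 1)
    (hdiag : Integrable (fun o => combinedKernel (propensity P A X) kY o o)
      (P.map (observed A X Yp)))
    (m : Fin d) {κ ψ : ℝ → ℝ} (hκ : Measurable κ) (hκ0 : ∫ u, κ u ≠ 0)
    (hψ : Antitone ψ) (hψ0 : ∀ u, 0 ≤ ψ u) (hψi : Integrable (fun u => ψ |u|))
    (hκψ : ∀ u, |κ u| ≤ ψ |u|) {h : ℕ → ℝ} (hh : Tendsto h atTop (𝓝[>] 0))
    (hnh : Tendsto (fun n : ℕ => (n : ℝ) * h n) atTop atTop) {p : ℝ → ℝ} (hp : Measurable p)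
    (hp0 : ∀ s, 0 ≤ p s)
    (hpT : P.map (fun ω => X ω m) = volume.withDensity fun s => ENNReal.ofReal (p s)) :
    ∀ᵐ x ∂(P.map (fun ω => X ω m)),
      TendstoInMeasure Q
        (fun n ω' => estimator kY n (fun i => O i ω')
          (smoothWeight (propensity P A X) κ (h n) m x n (fun i => O i ω')))
        atTop (fun _ => condMMDSq P X Yp kY m x) := by
  obtain ⟨H, _, _, _, φ, hφ⟩ := hkY_pos.exists_featureMap
  have hsymm := hkY_pos.kernel_symm
  have hkY0 : ∀ y, 0 ≤ kY y y := fun y => by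
    rw [← norm_sq_featureMap hφ]; positivity
  have hkY_meas := hkY_cont.measurable
  -- Continuity on the separable line makes `φ` strongly measurable, so Bochner integrals in `H` are
  -- available.
  have hφm : StronglyMeasurable φ := (continuous_featureMap hφ hkY_cont).stronglyMeasurable
  have hobs := measurable_observed hA hX hYp
  have : IsProbabilityMeasure (P.map (observed A X Yp)) :=
    Measure.isProbabilityMeasure_map hobs.aemeasurable
  have hT : Measurable fun ω => X ω m := (measurable_pi_apply m).comp hX
  have hTo : Measurable fun o : Obs d => o.2.1 m := by fun_prop
  have hmap : (P.map (observed A X Yp)).map (fun o => o.2.1 m) = P.map fun ω => X ω m := by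
    rw [Measure.map_map hTo hobs]
    rfl
  set μ := P.map (observed A X Yp) with hμ
  set e := propensity P A X with he
  have hw : ∀ a, Measurable (ipw e a) :=
    measurable_ipw (measurable_propensity (P := P) (A := A) (X := X))
  have hφo : StronglyMeasurable fun o : Obs d => φ o.2.2 := hφm.comp_measurable (by fun_prop)
  set Φ : Obs d → H := fun o => (ipw e 1 o - ipw e 0 o) • φ o.2.2 with hΦ
  have hΦm : StronglyMeasurable Φ := ((hw 1).sub (hw 0)).stronglyMeasurable.smul hφo
  have hΦsq : ∀ o, ‖Φ o‖ ^ 2 = combinedKernel e kY o o := fun o => by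
    rw [combinedKernel_eq_inner e hφ, ← real_inner_self_eq_norm_sq]
  have hΦLp : MemLp Φ 2 μ := by
    rw [memLp_two_iff_integrable_sq_norm hΦm.aestronglyMeasurable]
    simpa only [hΦsq] using hdiag
  have hφY : ∀ a, Integrable (fun ω => φ (Yp a ω)) P := fun a => by
    refine (integrable_sqrt_kernel_potential hA hX hYp h_ignorable h_positive hkY_meas hkY0
      hdiag a).mono' (hφm.comp_measurable (hYp a)).aestronglyMeasurable
      (Eventually.of_forall fun ω => ?_)
    rw [norm_featureMap hφ]
  have hwφ : ∀ a, Integrable (fun o => ipw e a o • φ o.2.2) μ := fun a => by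
    refine (integrable_ipw_mul_sqrt_kernel (P := P) (A := A) (X := X) hkY_meas hkY0 hdiag a).mono'
      ((hw a).stronglyMeasurable.smul hφo).aestronglyMeasurable (Eventually.of_forall fun o => ?_)
    rw [norm_smul, norm_featureMap hφ, Real.norm_of_nonneg (ipw_propensity_nonneg _ _)]
  have hac : P.map (fun ω => X ω m) ≪ volume := by
    rw [hpT]
    exact withDensity_absolutelyContinuous _ _
  have hppos : ∀ᵐ x ∂(P.map fun ω => X ω m), p x ≠ 0 := by
    rw [hpT, ae_withDensity_iff (by fun_prop)]
    refine Eventually.of_forall fun x hx hx0 => hx ?_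
    rw [hx0, ENNReal.ofReal_zero]
  have hpTo : μ.map (fun o => o.2.1 m) = volume.withDensity fun s => ENNReal.ofReal (p s) := by
    rw [hmap, hpT]
  have hmean := fun a => ae_tendsto_integral_rescale_condDistrib hT (hYp a) hφm (hφY a) hp hp0 hpT
    hκ hψ hψ0 hψi hκψ
  -- Smoothing the constant `1` gives the limit `(∫ κ) * p x` of the normalising sum.
  have hmean1 := ae_tendsto_integral_rescale_condDistrib (P := μ) (Z := id) (F := fun _ => (1 : ℝ))
    hTo measurable_id stronglyMeasurable_const (integrable_const _) hp hp0 hpTo hκ hψ hψ0 hψi hκψ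
  have hcm := fun a => ae_integrable_condDistrib hT (hYp a) hφm (hφY a)
  have hZ := ae_tendstoInMeasure_kernel_average hO hO_indep hO_law hTo hp hp0 hpTo hκ hψ hψ0 hψi
    hκψ hh hnh hΦm hΦLp
  have hS := ae_tendstoInMeasure_kernel_average hO hO_indep hO_law hTo hp hp0 hpTo hκ hψ hψ0 hψi
    hκψ hh hnh (Φ := fun _ => (1 : ℝ)) stronglyMeasurable_const (memLp_const _)
  filter_upwards [hac.ae_le (hmean 0), hac.ae_le (hmean 1), hac.ae_le hmean1, hcm 0, hcm 1,
    hac.ae_le hZ, hac.ae_le hS, hppos] with x hm0 hm1 hmone hc0 hc1 hZx hSx hpx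
  set M : Fin 2 → H := fun a => ∫ y, φ y ∂(condDistrib (Yp a) (fun ω => X ω m) P x) with hM
  have hbd : ∀ (n : ℕ) s, ‖1 / h n * κ ((s - x) / h n)‖ ≤ |1 / h n| * ψ 0 := fun n s => by
    rw [norm_mul, Real.norm_eq_abs, Real.norm_eq_abs]
    gcongr
    exact (hκψ _).trans (hψ (abs_nonneg _))
  have hvm : ∀ n, Measurable fun s => 1 / h n * κ ((s - x) / h n) := fun n => by fun_prop
  have hZmean : Tendsto (fun n => ∫ o, (1 / h n * κ ((o.2.1 m - x) / h n)) • Φ o ∂μ) atTop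
      (𝓝 (((∫ u, κ u) * p x) • (M 1 - M 0))) := by
    have hlim := (hm1.comp hh).sub (hm0.comp hh)
    rw [← smul_sub, ← smul_sub, smul_smul] at hlim
    refine hlim.congr fun n => ?_
    have hint : ∀ a, Integrable
        (fun o : Obs d => (1 / h n * κ ((o.2.1 m - x) / h n)) • ipw e a o • φ o.2.2) μ := fun a =>
      (hwφ a).bdd_smul _ ((hvm n).comp hTo).aestronglyMeasurable
        (Eventually.of_forall fun o => hbd n _)
    simp only [Function.comp_apply]
    rw [← integral_feature_smul_ipw_smul hA hX hYp h_ignorable h_positive m 1 hφm (hvm n),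
      ← integral_feature_smul_ipw_smul hA hX hYp h_ignorable h_positive m 0 hφm (hvm n),
      ← integral_sub (hint 1) (hint 0)]
    simp only [hΦ, sub_smul, smul_sub]
  have hSmean : Tendsto (fun n => ∫ o : Obs d, (1 / h n * κ ((o.2.1 m - x) / h n)) • (1 : ℝ) ∂μ)
      atTop (𝓝 ((∫ u, κ u) * p x)) := by
    have hlim := hmone.comp hh
    simpa [Function.comp_def] using hlim
  have hZt := hZx _ hZmean
  have hSt := hSx _ hSmean
  have hne : (∫ u, κ u) * p x ≠ 0 := mul_ne_zero hκ0 hpx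
  -- The factor `(∫ κ) * p x` occurs squared in both limits and cancels; it is nonzero because `p`
  -- vanishes only on a null set of the law of `X_m`.
  have hratio := hZt.map₂_const hSt (Φ := fun (a : H) (b : ℝ) => ‖a‖ ^ 2 / b ^ 2)
    (ContinuousAt.div (by fun_prop) (by fun_prop) (pow_ne_zero 2 hne))
  have hval : ‖((∫ u, κ u) * p x) • (M 1 - M 0)‖ ^ 2 / ((∫ u, κ u) * p x) ^ 2 =
      condMMDSq P X Yp kY m x := by
    rw [condMMDSq, mmdSq_eq_norm_sq hφ hc0 hc1, norm_smul, mul_pow, Real.norm_eq_abs, sq_abs]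
    exact mul_div_cancel_left₀ _ (pow_ne_zero 2 hne)
  rw [hval] at hratio
  refine hratio.congr' ?_ (ae_eq_refl _)
  filter_upwards [eventually_gt_atTop 0] with n hn
  have hn' : (n : ℝ) ≠ 0 := by exact_mod_cast hn.ne'
  refine Eventually.of_forall fun ω' => ?_
  have hest := estimator_eq e hsymm n (fun i => O i ω')
    (fun i => 1 / h n * κ (((O i ω').2.1 m - x) / h n))
    (∑ l ∈ Finset.range n, 1 / h n * κ (((O l ω').2.1 m - x) / h n))
  have hquad : ‖∑ i ∈ Finset.range n, (1 / h n * κ (((O i ω').2.1 m - x) / h n)) • Φ (O i ω')‖ ^ 2 =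
      ∑ i ∈ Finset.range n, ∑ j ∈ Finset.range n,
        (1 / h n * κ (((O i ω').2.1 m - x) / h n)) * (1 / h n * κ (((O j ω').2.1 m - x) / h n)) *
          combinedKernel e kY (O i ω') (O j ω') := by
    rw [← real_inner_self_eq_norm_sq, sum_inner]
    refine Finset.sum_congr rfl fun i _ => ?_
    rw [inner_sum]
    refine Finset.sum_congr rfl fun j _ => ?_
    rw [real_inner_smul_left, real_inner_smul_right, combinedKernel_eq_inner e hφ, ← mul_assoc]
  simp only [smul_eq_mul, mul_one]
  rw [norm_smul, mul_pow, mul_pow, Real.norm_eq_abs, sq_abs,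
    mul_div_mul_left _ _ (pow_ne_zero 2 (inv_ne_zero hn')), hquad, ← hest]
  rfl

end WCMMD

theorem theorem1
    -- the population
    {Ω : Type*} [MeasurableSpace Ω] [StandardBorelSpace Ω] (P : Measure Ω) [IsProbabilityMeasure P]
    {d : ℕ} (A : Ω → Fin 2) (X : Ω → Fin d → ℝ) (Yp : Fin 2 → Ω → ℝ)
    (hA : Measurable A) (hX : Measurable X) (hYp : ∀ a, Measurable (Yp a))
    -- the i.i.d. sample from the law of `(A, X, Y)`
    {Ω' : Type*} [MeasurableSpace Ω'] (Q : Measure Ω') [IsProbabilityMeasure Q]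
    (O : ℕ → Ω' → WCMMD.Obs d) (hO : ∀ i, Measurable (O i))
    (hO_indep : iIndepFun O Q)
    (hO_law : ∀ i, Q.map (O i) = P.map (WCMMD.observed A X Yp))
    -- the kernel on outcomes
    (kY : ℝ → ℝ → ℝ) (hkY_meas : Measurable (fun z : ℝ × ℝ => kY z.1 z.2))
    (hkY_pos : (Matrix.of kY).PosSemidef)
    -- conditional ignorability, positivity, square integrability
    (h_ignorable : CondIndepFun (MeasurableSpace.comap X inferInstance) hX.comap_le
      (fun ω => (Yp 0 ω, Yp 1 ω)) A P)
    (h_positive : ∀ᵐ x ∂(P.map X),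
      0 < WCMMD.propensity P A X x ∧ WCMMD.propensity P A X x < 1)
    (h_sqInt : WCMMD.SquareIntegrable (P.map (WCMMD.observed A X Yp))
      (WCMMD.combinedKernel (WCMMD.propensity P A X) kY))
    (m : Fin d) :
    -- indicator weights
    (∀ x : ℝ, P {ω | X ω m = x} ≠ 0 →
      TendstoInMeasure Q
        (fun n ω' => WCMMD.estimator kY n (fun i => O i ω')
          (WCMMD.discreteWeight (WCMMD.propensity P A X) m x n (fun i => O i ω')))
        atTop (fun _ => WCMMD.condMMDSq P X Yp kY m x)) ∧
    -- kernel-smoothing weights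
    (∀ (δ : ℕ) (κ : ℝ → ℝ) (h : ℕ → ℝ), 2 ≤ δ →
      Continuous (fun z : ℝ × ℝ => kY z.1 z.2) →
      WCMMD.IsSmoothingKernel δ κ →
      Tendsto h atTop (𝓝 0) →
      Tendsto (fun n : ℕ => (n : ℝ) * h n) atTop atTop →
      WCMMD.HasSmoothDensity δ (P.map (fun ω => X ω m)) →
      ∀ᵐ x ∂(P.map (fun ω => X ω m)),
        TendstoInMeasure Q
          (fun n ω' => WCMMD.estimator kY n (fun i => O i ω')
            (WCMMD.smoothWeight (WCMMD.propensity P A X) κ (h n) m x n (fun i => O i ω')))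
          atTop (fun _ => WCMMD.condMMDSq P X Yp kY m x)) := by
  refine ⟨fun x hx => WCMMD.tendstoInMeasure_discrete hA hX hYp hO hO_indep hO_law hkY_meas hkY_pos
    h_ignorable h_positive h_sqInt m hx, ?_⟩
  rintro δ κ h - hkY_cont hκ hh hnh ⟨p, hp, hp0, hpT⟩
  obtain ⟨ψ, hψ, hψi, hκψ⟩ := hκ.majorant
  obtain ⟨ψ', hψ', hψ0', hψi', hκψ'⟩ := exists_antitone_majorant hψ hψi hκψ
  -- Bandwidths are not assumed positive; eventual positivity follows from `n * h n → ∞`.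
  have hpos : ∀ᶠ n in atTop, h n ∈ Set.Ioi 0 := by
    filter_upwards [hnh.eventually_gt_atTop 0] with n hn
    exact pos_of_mul_pos_right hn (Nat.cast_nonneg n)
  exact WCMMD.ae_tendstoInMeasure_smooth hA hX hYp hO hO_indep hO_law hkY_cont hkY_pos h_ignorable
    h_positive h_sqInt.diag m hκ.measurable hκ.integral_ne_zero hψ' hψ0' hψi' hκψ'
    (tendsto_nhdsWithin_iff.2 ⟨hh, hpos⟩) hnh hp.continuous.measurable hp0 hpT
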